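/- Let $k=\mathbb F_q$ be a finite field, $X$ a smooth geometrically connected projective curve of genus $g_X$ over $k$, $p\in X(k)$, and $X_\infty=\varprojlim_n X_n$ the infinite root stack of $X$ at $p$. Put $\widetilde{\mathbb Q}=\mathbb Q[\upsilon,\upsilon^{-1}]/(\upsilon^2-q)$ and $S^1_{\mathbb Q}=\mathbb Q/\mathbb Z$. Let $\mathsf{Tor}_{p_\infty}(X_\infty)=\varinjlim_n \mathsf{Rep}^{\mathsf{nil}}_k(A^{(1)}_{n-1})$ be the category of torsion sheaves on $X_\infty$ supported at the stacky point. Its objects are the nilpotent finite-dimensional $k$-representations of the cyclic quivers with vertices $0,\frac1n,\dots,\frac{n-1}n$ and arrows $\frac in\to\frac{i+1}n$; a representation of level $n$ is identified with the one of level $mn$ obtained by repeating each space $m$ times, with identity maps in between. The class of an object $F$ is its dimension function $\overline F=(0,\underline{\dim} F)$ in $\mathsf K_0^{\mathsf{num}}(X_\infty)=\mathbb Z\oplus\mathbb Z_0^{S^1_{\mathbb Q}}$, where $\mathbb Z_0^{S^1_{\mathbb Q}}$ is the group of functions $S^1_{\mathbb Q}\to\mathbb Z$ that, for some $n\ge1$,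 are constant on all intervals $[\frac in,\frac{i+1}n[$. With $h_\pm(x)=\lim_{t\to0,\,t>0}h(x\pm t)$, the Euler form is $$\langle (r,f),(s,g)\rangle = rs(1-g_X)+r\,g_+(0)-s\,f_-(0)+\sum_{x\in S^1_{\mathbb Q}}f_-(x)\big(g_-(x)-g_+(x)\big),$$ and $(\alpha,\beta)=\langle\alpha,\beta\rangle+\langle\beta,\alpha\rangle$. Let $\mathbf H^{\mathsf{tor}}_{\infty,p_\infty}$ be the $\widetilde{\mathbb Q}$-algebra of finitely supported $\widetilde{\mathbb Q}$-valued functions on the isomorphism classes of objects of $\mathsf{Tor}_{p_\infty}(X_\infty)$, with basis the characteristic functions $1_F$ and with product $$(f\cdot g)(R)=\sum_{N\subseteq R}\upsilon^{\langle \overline{R/N},\overline N\rangle}f(R/N)\,g(N).$$ Let $\mathbf H^{\mathsf{tw},\mathsf{tor}}_{\infty,p_\infty}=\mathbf H^{\mathsf{tor}}_{\infty,p_\infty}\otimes_{\widetilde{\mathbb Q}}\widetilde{\mathbb Q}[\mathsf K_0^{\mathsf{num}}(X_\infty)]$ be the extended Hall algebra, in which $\mathbf k_\alpha\mathbf k_\beta=\mathbf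 k_{\alpha+\beta}$ and $\mathbf k_\alpha 1_F\mathbf k_\alpha^{-1}=\upsilon^{(\alpha,\overline F)}1_F$. Then the center of $\mathbf H^{\mathsf{tw},\mathsf{tor}}_{\infty,p_\infty}$ is trivial, in the following sense: it is the subalgebra $\widetilde{\mathbb Q}[\mathbf k_\delta^{\pm1}]$ generated by $\mathbf k_\delta^{\pm1}$, where $\delta=(0,1)$ is the class of the constant function $1$ (these elements are central because $(\delta,\overline F)=0$ for all $F$). Moreover, the center of $\mathbf H^{\mathsf{tor}}_{\infty,p_\infty}$ itself is $\widetilde{\mathbb Q}\cdot 1$. -/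

import Mathlib

open Filter Topology

noncomputable section

namespace InfiniteRootHall

universe u

/-- The coefficient ring `ℚ[υ, υ⁻¹] / (υ² - q)`, where `q` is the number of elements of `k`. -/
abbrev Scalars (k : Type u) : Type :=
  LaurentPolynomial ℚ ⧸
    Ideal.span {(LaurentPolynomial.T 2 - LaurentPolynomial.C (Nat.card k : ℚ) :
      LaurentPolynomial ℚ)}

/-- The power `υ ^ m` in the coefficient ring, for an integer `m`. -/
def ups (k : Type u) (m : ℤ) : Scalars k :=
  Ideal.Quotient.mk _ (LaurentPolynomial.T m)

theorem ups_zero (k : Type u) : ups k 0 = 1 := by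
  simp [ups]

theorem ups_add (k : Type u) (m n : ℤ) : ups k (m + n) = ups k m * ups k n := by
  rw [ups, ups, ups, LaurentPolynomial.T_add, map_mul]

/-- The rational circle `S¹_ℚ = ℚ / ℤ`. -/
abbrev RatCircle : Type := AddCircle (1 : ℚ)

/-- `f` is constant on all intervals `[i / n, (i + 1) / n[`. -/
def IsStep (n : ℕ) (f : RatCircle → ℤ) : Prop :=
  ∀ (i : ℤ) (s : ℚ), 0 ≤ s → s * n < 1 → f ((i / n + s : ℚ) : RatCircle) = f ((i / n : ℚ) : RatCircle)

theorem exists_cell (n : ℕ) (hn : 0 < n) (b : RatCircle) :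
    ∃ (i : ℤ) (s : ℚ), 0 ≤ s ∧ s * n < 1 ∧ b = ((i / n + s : ℚ) : RatCircle) := by
  obtain ⟨x, rfl⟩ := QuotientAddGroup.mk_surjective b
  have hn' : (0 : ℚ) < n := by exact_mod_cast hn
  refine ⟨⌊x * n⌋, x - ⌊x * n⌋ / n, ?_, ?_, ?_⟩
  · have := Int.floor_le (x * n)
    rw [sub_nonneg, div_le_iff₀ hn']; exact this
  · have := Int.lt_floor_add_one (x * n)
    rw [sub_mul, div_mul_cancel₀ _ hn'.ne']; linarith
  · congr 1; ring

/-- A point of a cell of the `m * n`-subdivision lies in a cell of the `n`-subdivision, together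
with the left end point of its smaller cell. -/
theorem exists_coarse (n m : ℕ) (hn : 0 < n) (hm : 0 < m) (i : ℤ) :
    ∃ (j : ℤ) (r : ℚ), 0 ≤ r ∧ (i / (n * m : ℕ) : ℚ) = j / n + r ∧
      ∀ s : ℚ, s * (n * m : ℕ) < 1 → (r + s) * n < 1 := by
  have hn' : (0 : ℚ) < n := by exact_mod_cast hn
  have hm' : (0 : ℚ) < m := by exact_mod_cast hm
  have hmz : (0 : ℤ) < m := by exact_mod_cast hm
  have h1 : (i : ℚ) = m * ((i / (m : ℤ) : ℤ) : ℚ) + ((i % (m : ℤ) : ℤ) : ℚ) := by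
    exact_mod_cast (Int.mul_ediv_add_emod i m).symm
  have h2 : (0 : ℚ) ≤ ((i % (m : ℤ) : ℤ) : ℚ) := by exact_mod_cast Int.emod_nonneg i hmz.ne'
  have h3 : ((i % (m : ℤ) : ℤ) : ℚ) + 1 ≤ m := by exact_mod_cast Int.emod_lt_of_pos i hmz
  refine ⟨i / (m : ℤ), ((i % (m : ℤ) : ℤ) : ℚ) / (n * m), by positivity, ?_, ?_⟩
  · push_cast
    rw [h1]; field_simp
  · intro s hs
    push_cast at hs
    have : (((i % (m : ℤ) : ℤ) : ℚ) / (n * m) + s) * n = (((i % (m : ℤ) : ℤ) : ℚ) + s * (n * m)) / m := by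
      field_simp
    rw [this, div_lt_one hm']
    linarith

theorem IsStep.mul {n m : ℕ} (hn : 0 < n) (hm : 0 < m) {f : RatCircle → ℤ} (h : IsStep n f) :
    IsStep (n * m) f := by
  intro i s hs hs'
  obtain ⟨j, r, hr, he, hlt⟩ := exists_coarse n m hn hm i
  rw [he, add_assoc, h j (r + s) (by positivity) (hlt s hs'),
    h j r hr (by simpa using hlt 0 (by simp))]

/-- The group `ℤ_0^{S¹_ℚ}` of functions on the rational circle that are constant on all intervals
`[i / n, (i + 1) / n[` for some positive integer `n`. -/
def StepFun : AddSubgroup (RatCircle → ℤ) where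
  carrier := {f | ∃ n : ℕ, 0 < n ∧ IsStep n f}
  zero_mem' := ⟨1, one_pos, fun _ _ _ _ => rfl⟩
  add_mem' := by
    rintro f g ⟨n, hn, hf⟩ ⟨m, hm, hg⟩
    refine ⟨n * m, Nat.mul_pos hn hm, fun i s hs hs' => ?_⟩
    have h2 := (hg.mul hm hn)
    rw [mul_comm m n] at h2
    simp only [Pi.add_apply]
    rw [hf.mul hn hm i s hs hs', h2 i s hs hs']
  neg_mem' := by
    rintro f ⟨n, hn, hf⟩
    refine ⟨n, hn, fun i s hs hs' => ?_⟩
    simp only [Pi.neg_apply]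
    rw [hf i s hs hs']

/-- The left limit `f₋(x) = lim_{t → 0, t > 0} f (x - t)`. -/
def leftLimit (f : RatCircle → ℤ) (x : RatCircle) : ℤ :=
  limUnder (𝓝[>] (0 : ℚ)) fun t : ℚ => f (x - (t : RatCircle))

/-- The right limit `f₊(x) = lim_{t → 0, t > 0} f (x + t)`. -/
def rightLimit (f : RatCircle → ℤ) (x : RatCircle) : ℤ :=
  limUnder (𝓝[>] (0 : ℚ)) fun t : ℚ => f (x + (t : RatCircle))

theorem IsStep.eventually_right {n : ℕ} (hn : 0 < n) {f : RatCircle → ℤ} (hf : IsStep n f)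
    (x : RatCircle) : ∀ᶠ t : ℚ in 𝓝[>] (0 : ℚ), f (x + (t : RatCircle)) = f x := by
  have hn' : (0 : ℚ) < n := by exact_mod_cast hn
  obtain ⟨i, s, hs, hs', rfl⟩ := exists_cell n hn x
  have hpos : 0 < 1 / (n : ℚ) - s := by
    rw [sub_pos, lt_div_iff₀ hn']; exact hs'
  filter_upwards [Ioo_mem_nhdsGT hpos] with t ht
  have h1 : (s + t) * n < 1 := by
    have := ht.2
    rw [lt_sub_iff_add_lt, lt_div_iff₀ hn'] at this
    linarith [add_comm t s ▸ this]
  rw [hf i s hs hs', ← AddCircle.coe_add, add_assoc]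
  exact hf i (s + t) (add_nonneg hs ht.1.le) h1

theorem IsStep.eventually_left {n : ℕ} (hn : 0 < n) {f : RatCircle → ℤ} (hf : IsStep n f)
    (i : ℤ) (s : ℚ) (hs : 0 < s) (hs' : s * n ≤ 1) :
    ∀ᶠ t : ℚ in 𝓝[>] (0 : ℚ), f (((i / n + s : ℚ) : RatCircle) - (t : RatCircle)) =
      f ((i / n : ℚ) : RatCircle) := by
  have hn' : (0 : ℚ) < n := by exact_mod_cast hn
  filter_upwards [Ioo_mem_nhdsGT hs] with t ht
  rw [← AddCircle.coe_sub, add_sub_assoc]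
  refine hf i (s - t) (by linarith [ht.2]) ?_
  have : 0 < t * n := mul_pos ht.1 hn'
  rw [sub_mul]; linarith

theorem rightLimit_eq {n : ℕ} (hn : 0 < n) {f : RatCircle → ℤ} (hf : IsStep n f)
    (x : RatCircle) : rightLimit f x = f x :=
  Tendsto.limUnder_eq (tendsto_const_nhds.congr' (EventuallyEq.symm (hf.eventually_right hn x)))

theorem exists_cell_left (n : ℕ) (hn : 0 < n) (b : RatCircle) :
    ∃ (i : ℤ) (s : ℚ), 0 < s ∧ s * n ≤ 1 ∧ b = ((i / n + s : ℚ) : RatCircle) := by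
  have hn' : (0 : ℚ) < n := by exact_mod_cast hn
  obtain ⟨i, s, hs, hs', rfl⟩ := exists_cell n hn b
  rcases hs.eq_or_lt with rfl | h
  · refine ⟨i - 1, 1 / n, by positivity, by field_simp; rfl, ?_⟩
    congr 1; push_cast; field_simp; ring
  · exact ⟨i, s, h, hs'.le, rfl⟩

theorem leftLimit_eq {n : ℕ} (hn : 0 < n) {f : RatCircle → ℤ} (hf : IsStep n f)
    (i : ℤ) (s : ℚ) (hs : 0 < s) (hs' : s * n ≤ 1) :
    leftLimit f ((i / n + s : ℚ) : RatCircle) = f ((i / n : ℚ) : RatCircle) :=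
  Tendsto.limUnder_eq
    (tendsto_const_nhds.congr' (EventuallyEq.symm (hf.eventually_left hn i s hs hs')))

theorem exists_common (f g : StepFun) : ∃ n : ℕ, 0 < n ∧ IsStep n f ∧ IsStep n g := by
  obtain ⟨n, hn, hf⟩ := f.2
  obtain ⟨m, hm, hg⟩ := g.2
  exact ⟨n * m, Nat.mul_pos hn hm, hf.mul hn hm, by rw [mul_comm]; exact hg.mul hm hn⟩

theorem IsStep.add {n : ℕ} {f g : RatCircle → ℤ} (hf : IsStep n f) (hg : IsStep n g) :
    IsStep n (f + g) := fun i s hs hs' => by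
  simp only [Pi.add_apply]; rw [hf i s hs hs', hg i s hs hs']

theorem rightLimit_add (f g : StepFun) (x : RatCircle) :
    rightLimit (f + g : StepFun) x = rightLimit f x + rightLimit g x := by
  obtain ⟨n, hn, hf, hg⟩ := exists_common f g
  rw [rightLimit_eq hn hf, rightLimit_eq hn hg, AddSubgroup.coe_add, rightLimit_eq hn (hf.add hg)]
  rfl

theorem leftLimit_add (f g : StepFun) (x : RatCircle) :
    leftLimit (f + g : StepFun) x = leftLimit f x + leftLimit g x := by
  obtain ⟨n, hn, hf, hg⟩ := exists_common f g
  obtain ⟨i, s, hs, hs', rfl⟩ := exists_cell_left n hn x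
  rw [leftLimit_eq hn hf i s hs hs', leftLimit_eq hn hg i s hs hs', AddSubgroup.coe_add,
    leftLimit_eq hn (hf.add hg) i s hs hs']
  rfl

theorem finite_vertices (n : ℕ) (hn : 0 < n) :
    {x : RatCircle | ∃ i : ℤ, x = ((i / n : ℚ) : RatCircle)}.Finite := by
  have hn' : (0 : ℚ) < n := by exact_mod_cast hn
  refine (Set.finite_range fun i : Fin n => (((i : ℕ) / n : ℚ) : RatCircle)).subset ?_
  rintro x ⟨i, rfl⟩
  have hnz : (0 : ℤ) < n := by exact_mod_cast hn
  have h1 : (i : ℚ) = n * ((i / (n : ℤ) : ℤ) : ℚ) + ((i % (n : ℤ) : ℤ) : ℚ) := by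
    exact_mod_cast (Int.mul_ediv_add_emod i n).symm
  have h2 := Int.emod_nonneg i hnz.ne'
  have h3 := Int.emod_lt_of_pos i hnz
  refine ⟨⟨(i % (n : ℤ)).toNat, by omega⟩, ?_⟩
  have h4 : (((i % (n : ℤ)).toNat : ℕ) : ℚ) = ((i % (n : ℤ) : ℤ) : ℚ) := by
    exact_mod_cast Int.toNat_of_nonneg h2
  simp only [h4]
  refine QuotientAddGroup.eq.2 ⟨i / (n : ℤ), ?_⟩
  simp only [zsmul_eq_mul, mul_one]
  rw [h1]
  field_simp
  simp

theorem finite_jumps (f g : StepFun) :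
    {x | leftLimit f x * (leftLimit g x - rightLimit g x) ≠ 0}.Finite := by
  obtain ⟨n, hn, hg⟩ := g.2
  refine (finite_vertices n hn).subset ?_
  intro x hx
  by_contra hcon
  apply hx
  obtain ⟨i, s, hs, hs', rfl⟩ := exists_cell n hn x
  rcases hs.eq_or_lt with rfl | h
  · exact (hcon ⟨i, by simp⟩).elim
  · rw [rightLimit_eq hn hg, leftLimit_eq hn hg i s h hs'.le, hg i s hs hs', sub_self, mul_zero]

/-- The Euler form on the classes of torsion sheaves,
`⟨f, g⟩ = ∑_x f₋(x) (g₋(x) - g₊(x))`. -/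
def eulerTor (f g : StepFun) : ℤ :=
  ∑ᶠ x : RatCircle, leftLimit f x * (leftLimit g x - rightLimit g x)

theorem eulerTor_add_left (f f' g : StepFun) :
    eulerTor (f + f') g = eulerTor f g + eulerTor f' g := by
  unfold eulerTor
  rw [← finsum_add_distrib (finite_jumps f g) (finite_jumps f' g)]
  refine finsum_congr fun x => ?_
  rw [leftLimit_add]; ring

theorem eulerTor_add_right (f g g' : StepFun) :
    eulerTor f (g + g') = eulerTor f g + eulerTor f g' := by
  unfold eulerTor
  rw [← finsum_add_distrib (finite_jumps f g) (finite_jumps f g')]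
  refine finsum_congr fun x => ?_
  rw [leftLimit_add, rightLimit_add]; ring

theorem eulerTor_zero_left (g : StepFun) : eulerTor 0 g = 0 := by
  simpa using eulerTor_add_left 0 0 g

theorem eulerTor_zero_right (f : StepFun) : eulerTor f 0 = 0 := by
  simpa using eulerTor_add_right f 0 0

/-- The numerical Grothendieck group `ℤ ⊕ ℤ_0^{S¹_ℚ}` of the infinite root stack over a curve of
genus `genus`; the first component is the rank. -/
def KNum (_genus : ℕ) : Type := ℤ × StepFun

instance (genus : ℕ) : AddCommGroup (KNum genus) := inferInstanceAs (AddCommGroup (ℤ × StepFun))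

/-- The class `(r, f)`. -/
def KNum.mk {genus : ℕ} (r : ℤ) (f : StepFun) : KNum genus := (r, f)

/-- The Euler form of the infinite root stack over a curve of genus `genus`. -/
def euler {genus : ℕ} (α β : KNum genus) : ℤ :=
  α.1 * β.1 * (1 - genus) + α.1 * rightLimit β.2 0 - β.1 * leftLimit α.2 0 + eulerTor α.2 β.2

/-- The symmetrised Euler form. -/
def symEuler {genus : ℕ} (α β : KNum genus) : ℤ := euler α β + euler β α

theorem euler_add_left {genus : ℕ} (α α' β : KNum genus) :
    euler (α + α') β = euler α β + euler α' β := by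
  change (α.1 + α'.1) * β.1 * (1 - genus) + (α.1 + α'.1) * rightLimit β.2 0
    - β.1 * leftLimit (α.2 + α'.2 : StepFun) 0 + eulerTor (α.2 + α'.2) β.2 = _
  rw [leftLimit_add, eulerTor_add_left]; unfold euler; ring

theorem euler_add_right {genus : ℕ} (α β β' : KNum genus) :
    euler α (β + β') = euler α β + euler α β' := by
  change α.1 * (β.1 + β'.1) * (1 - genus) + α.1 * rightLimit (β.2 + β'.2 : StepFun) 0
    - (β.1 + β'.1) * leftLimit α.2 0 + eulerTor α.2 (β.2 + β'.2) = _
  rw [rightLimit_add, eulerTor_add_right]; unfold euler; ring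

theorem symEuler_add_left {genus : ℕ} (α α' β : KNum genus) :
    symEuler (α + α') β = symEuler α β + symEuler α' β := by
  unfold symEuler; rw [euler_add_left, euler_add_right]; ring

theorem symEuler_add_right {genus : ℕ} (α β β' : KNum genus) :
    symEuler α (β + β') = symEuler α β + symEuler α β' := by
  unfold symEuler; rw [euler_add_left, euler_add_right]; ring

/-- The image of a nonnegative rational number in `ℚ / ℤ`. -/
def pt (s : ℚ≥0) : RatCircle := ((s : ℚ) : RatCircle)

theorem pt_zero : pt 0 = 0 := by simp [pt]

theorem pt_add (s t : ℚ≥0) : pt (s + t) = pt s + pt t := by simp [pt]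

/-- The vertex `i / n` of the circle. -/
def vtx (n : ℕ) (i : ℤ) : RatCircle := ((i / n : ℚ) : RatCircle)

/-- A torsion sheaf supported at the stacky point of the infinite root stack: a nilpotent
representation over `k` of the "cyclic quiver" with set of vertices `ℚ / ℤ`, that is, a
`ℚ / ℤ`-graded module over `k[x ^ s : s ∈ ℚ, s ≥ 0]`, where `x ^ s` is of degree `s`, on which some
power of `x` is zero, and which is coherent, i.e. comes from a representation of the cyclic quiver
with vertices `0, 1 / n, …, (n - 1) / n` and arrows `i / n → (i + 1) / n` by pull-back
(which repeats the space at `i / n` on the whole interval `[i / n, (i + 1) / n[`). -/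
structure TorSheaf (k : Type u) [Field k] where
  V : RatCircle → Type u
  [grp : ∀ a, AddCommGroup (V a)]
  [mod : ∀ a, Module k (V a)]
  [fin : ∀ a, Module.Finite k (V a)]
  /-- multiplication by `x ^ s`, from degree `a` to degree `b = a + s` -/
  act : ∀ (s : ℚ≥0) {a b : RatCircle}, b = a + pt s → V a →ₗ[k] V b
  act_zero : ∀ {a : RatCircle} (h : a = a + pt 0) (v : V a), act 0 h v = v
  act_add : ∀ (s t : ℚ≥0) {a b c : RatCircle} (h : b = a + pt s) (h' : c = b + pt t)
    (h'' : c = a + pt (s + t)) (v : V a), act t h' (act s h v) = act (s + t) h'' v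
  nilpotent : ∃ N : ℕ, ∀ {a b : RatCircle} (h : b = a + pt N) (v : V a), act N h v = 0
  coherent : ∃ n : ℕ, 0 < n ∧ ∀ (i : ℤ) (s : ℚ≥0), s * n < 1 →
    ∀ {b : RatCircle} (h : b = vtx n i + pt s), Function.Bijective (act s h)

namespace TorSheaf

variable {k : Type u} [Field k]

attribute [instance] TorSheaf.grp TorSheaf.mod TorSheaf.fin

/-- The sheaf comes from the `n`-th root stack. -/
def IsLevel (M : TorSheaf k) (n : ℕ) : Prop :=
  ∀ (i : ℤ) (s : ℚ≥0), s * n < 1 →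
    ∀ {b : RatCircle} (h : b = vtx n i + pt s), Function.Bijective (M.act s h)

theorem exists_vtx (n : ℕ) (hn : 0 < n) (b : RatCircle) :
    ∃ (i : ℤ) (s : ℚ≥0), s * n < 1 ∧ b = vtx n i + pt s := by
  obtain ⟨i, s, hs, hs', rfl⟩ := exists_cell n hn b
  refine ⟨i, ⟨s, hs⟩, ?_, ?_⟩
  · exact_mod_cast (show ((⟨s, hs⟩ : ℚ≥0) : ℚ) * n < 1 from hs')
  · simp [vtx, pt]

theorem vtx_coarse (n m : ℕ) (hn : 0 < n) (hm : 0 < m) (i : ℤ) :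
    ∃ (j : ℤ) (r : ℚ≥0), vtx (n * m) i = vtx n j + pt r ∧
      ∀ s : ℚ≥0, s * (n * m : ℕ) < 1 → (r + s) * n < 1 := by
  obtain ⟨j, r, hr, he, hlt⟩ := exists_coarse n m hn hm i
  refine ⟨j, ⟨r, hr⟩, ?_, fun s hs => ?_⟩
  · simp only [vtx, pt]; rw [he]; simp
  · have h1 : (s : ℚ) * (n * m : ℕ) < 1 := by exact_mod_cast hs
    have h2 := hlt s h1
    exact_mod_cast (show (((⟨r, hr⟩ : ℚ≥0) : ℚ) + s) * n < 1 from h2)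

theorem IsLevel.mul {M : TorSheaf k} {n m : ℕ} (hn : 0 < n) (hm : 0 < m) (h : M.IsLevel n) :
    M.IsLevel (n * m) := by
  intro i s hs b hb
  obtain ⟨j, r, he, hlt⟩ := vtx_coarse n m hn hm i
  have h1 : Function.Bijective (M.act r he) := h j r (by simpa using hlt 0 (by simp)) he
  have hb' : b = vtx n j + pt (r + s) := by rw [hb, he, pt_add, add_assoc]
  have h2 : Function.Bijective (M.act (r + s) hb') := h j (r + s) (hlt s hs) hb'
  have h3 : (M.act s hb) ∘ (M.act r he) = M.act (r + s) hb' :=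
    funext fun v => M.act_add r s he hb hb' v
  rw [← h3] at h2
  exact (Function.Bijective.of_comp_iff _ h1).1 h2

theorem IsLevel.mul' {M : TorSheaf k} {n m : ℕ} (hn : 0 < n) (hm : 0 < m) (h : M.IsLevel m) :
    M.IsLevel (n * m) := by
  rw [mul_comm]; exact h.mul hm hn

theorem exists_level (M : TorSheaf k) : ∃ n : ℕ, 0 < n ∧ M.IsLevel n := M.coherent

/-- An isomorphism of torsion sheaves. -/
structure Iso (M N : TorSheaf k) where
  equiv : ∀ a, M.V a ≃ₗ[k] N.V a
  comm : ∀ (s : ℚ≥0) {a b : RatCircle} (h : b = a + pt s) (v : M.V a),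
    equiv b (M.act s h v) = N.act s h (equiv a v)

/-- The identity isomorphism. -/
def Iso.refl (M : TorSheaf k) : Iso M M := ⟨fun _ => LinearEquiv.refl k _, fun _ _ _ _ _ => rfl⟩

/-- The inverse isomorphism. -/
def Iso.symm {M N : TorSheaf k} (e : Iso M N) : Iso N M :=
  ⟨fun a => (e.equiv a).symm, fun s a b h v => by
    rw [LinearEquiv.symm_apply_eq, e.comm, LinearEquiv.apply_symm_apply]⟩

/-- The composition of two isomorphisms. -/
def Iso.trans {M N P : TorSheaf k} (e : Iso M N) (f : Iso N P) : Iso M P :=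
  ⟨fun a => (e.equiv a).trans (f.equiv a), fun s a b h v => by
    simp [e.comm, f.comm]⟩

theorem IsLevel.iso {M N : TorSheaf k} (e : Iso M N) {n : ℕ} (h : M.IsLevel n) : N.IsLevel n := by
  intro i s hs b hb
  have h1 : N.act s hb = (e.equiv b) ∘ (M.act s hb) ∘ (e.equiv _).symm := by
    funext v; simp [e.comm]
  rw [h1]
  exact (e.equiv b).bijective.comp ((h i s hs hb).comp (e.equiv _).symm.bijective)

instance isoSetoid (k : Type u) [Field k] : Setoid (TorSheaf k) where
  r M N := Nonempty (Iso M N)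
  iseqv := ⟨fun M => ⟨Iso.refl M⟩, fun ⟨e⟩ => ⟨e.symm⟩, fun ⟨e⟩ ⟨f⟩ => ⟨e.trans f⟩⟩

/-- The dimension of a torsion sheaf, which is its class in the numerical Grothendieck group. -/
def dim (M : TorSheaf k) : StepFun :=
  ⟨fun a => (Module.finrank k (M.V a) : ℤ), by
    obtain ⟨n, hn, h⟩ := M.exists_level
    refine ⟨n, hn, fun i s hs hs' => ?_⟩
    have h1 : ((i / n + s : ℚ) : RatCircle) = vtx n i + pt ⟨s, hs⟩ := by simp [vtx, pt]
    have h2 := h i ⟨s, hs⟩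
      (by exact_mod_cast (show ((⟨s, hs⟩ : ℚ≥0) : ℚ) * n < 1 from hs')) h1
    exact congrArg Nat.cast (LinearEquiv.ofBijective _ h2).finrank_eq.symm⟩

theorem dim_iso {M N : TorSheaf k} (e : Iso M N) : M.dim = N.dim := by
  ext a
  exact congrArg Nat.cast (e.equiv a).finrank_eq

/-- The zero sheaf. -/
def zero (k : Type u) [Field k] : TorSheaf k where
  V _ := PUnit
  act _ _ _ _ := 0
  act_zero _ _ := rfl
  act_add _ _ _ _ _ _ _ _ _ := rfl
  nilpotent := ⟨0, fun _ _ => rfl⟩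
  coherent := ⟨1, one_pos, fun _ _ _ _ _ =>
    ⟨fun _ _ _ => rfl, fun _ => ⟨PUnit.unit, rfl⟩⟩⟩

/-- A (coherent) subsheaf of a torsion sheaf. -/
@[ext]
structure Sub (R : TorSheaf k) where
  carrier : ∀ a, Submodule k (R.V a)
  act_mem : ∀ (s : ℚ≥0) {a b : RatCircle} (h : b = a + pt s) (v : R.V a),
    v ∈ carrier a → R.act s h v ∈ carrier b
  coherent : ∃ n : ℕ, 0 < n ∧ ∀ (i : ℤ) (s : ℚ≥0), s * n < 1 →
    ∀ {b : RatCircle} (h : b = vtx n i + pt s) (w : R.V b), w ∈ carrier b →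
      ∃ v ∈ carrier (vtx n i), R.act s h v = w

namespace Sub

variable {R : TorSheaf k}

/-- The subsheaf comes from the `n`-th root stack, if the ambient sheaf does. -/
def IsLevel (L : Sub R) (n : ℕ) : Prop :=
  ∀ (i : ℤ) (s : ℚ≥0), s * n < 1 →
    ∀ {b : RatCircle} (h : b = vtx n i + pt s) (w : R.V b), w ∈ L.carrier b →
      ∃ v ∈ L.carrier (vtx n i), R.act s h v = w

theorem IsLevel.mul {L : Sub R} {n m : ℕ} (hn : 0 < n) (hm : 0 < m) (h : L.IsLevel n) :
    L.IsLevel (n * m) := by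
  intro i s hs b hb w hw
  obtain ⟨j, r, he, hlt⟩ := vtx_coarse n m hn hm i
  have hb' : b = vtx n j + pt (r + s) := by rw [hb, he, pt_add, add_assoc]
  obtain ⟨v, hv, rfl⟩ := h j (r + s) (hlt s hs) hb' w hw
  exact ⟨R.act r he v, L.act_mem r he v hv, R.act_add r s he hb hb' v⟩

theorem IsLevel.mul' {L : Sub R} {n m : ℕ} (hn : 0 < n) (hm : 0 < m) (h : L.IsLevel m) :
    L.IsLevel (n * m) := by
  rw [mul_comm]; exact h.mul hm hn

theorem exists_level (L : Sub R) : ∃ n : ℕ, 0 < n ∧ R.IsLevel n ∧ L.IsLevel n := by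
  obtain ⟨n, hn, h⟩ := R.exists_level
  obtain ⟨m, hm, h'⟩ := L.coherent
  exact ⟨n * m, Nat.mul_pos hn hm, h.mul hn hm, IsLevel.mul' hn hm h'⟩

/-- The subsheaf as a sheaf of its own. -/
def obj (L : Sub R) : TorSheaf k where
  V a := L.carrier a
  act s _ _ h := (R.act s h).restrict (L.act_mem s h)
  act_zero h v := Subtype.ext (R.act_zero h v)
  act_add s t _ _ _ h h' h'' v := Subtype.ext (R.act_add s t h h' h'' v)
  nilpotent := by
    obtain ⟨N, hN⟩ := R.nilpotent
    exact ⟨N, fun h v => Subtype.ext (hN h v)⟩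
  coherent := by
    obtain ⟨n, hn, h, h'⟩ := L.exists_level
    refine ⟨n, hn, fun i s hs b hb => ⟨fun v w hvw => ?_, fun w => ?_⟩⟩
    · exact Subtype.ext ((h i s hs hb).1 (congrArg Subtype.val hvw))
    · obtain ⟨v, hv, hvw⟩ := h' i s hs hb w w.2
      exact ⟨⟨v, hv⟩, Subtype.ext hvw⟩

/-- The quotient sheaf `R / L`. -/
def quot (L : Sub R) : TorSheaf k where
  V a := R.V a ⧸ L.carrier a
  act s a b h := (L.carrier a).mapQ (L.carrier b) (R.act s h) (L.act_mem s h)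
  act_zero {a} h v := by
    obtain ⟨v, rfl⟩ := (L.carrier a).mkQ_surjective v
    simp [R.act_zero h v]
  act_add s t {a b c} h h' h'' v := by
    obtain ⟨v, rfl⟩ := (L.carrier a).mkQ_surjective v
    simp [R.act_add s t h h' h'' v]
  nilpotent := by
    obtain ⟨N, hN⟩ := R.nilpotent
    refine ⟨N, fun {a b} h v => ?_⟩
    obtain ⟨v, rfl⟩ := (L.carrier a).mkQ_surjective v
    simp [hN h v]
  coherent := by
    obtain ⟨n, hn, h, h'⟩ := L.exists_level
    refine ⟨n, hn, fun i s hs b hb => ⟨?_, fun w => ?_⟩⟩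
    · rw [injective_iff_map_eq_zero]
      intro v hv
      obtain ⟨v, rfl⟩ := (L.carrier _).mkQ_surjective v
      rw [Submodule.mkQ_apply, Submodule.mapQ_apply, Submodule.Quotient.mk_eq_zero] at hv
      obtain ⟨v', hv', he⟩ := h' i s hs hb _ hv
      rw [← (h i s hs hb).1 he]
      simpa using hv'
    · obtain ⟨w, rfl⟩ := (L.carrier _).mkQ_surjective w
      obtain ⟨v, rfl⟩ := (h i s hs hb).2 w
      exact ⟨(L.carrier _).mkQ v, rfl⟩

theorem dim_add (L : Sub R) : L.quot.dim + L.obj.dim = R.dim := by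
  ext a
  have h := congrArg (Nat.cast (R := ℤ)) (L.carrier a).finrank_quotient_add_finrank
  rw [Nat.cast_add] at h
  exact h

theorem isLevel_obj {L : Sub R} {n : ℕ} (h : L.obj.IsLevel n) : L.IsLevel n := by
  intro i s hs b hb w hw
  obtain ⟨v, hv⟩ := (h i s hs hb).2 ⟨w, hw⟩
  exact ⟨v.1, v.2, congrArg Subtype.val hv⟩

theorem isLevel_ext {L : Sub R} {n : ℕ} (h : L.obj.IsLevel n) (h' : L.quot.IsLevel n) :
    R.IsLevel n := by
  intro i s hs b hb
  constructor
  · rw [injective_iff_map_eq_zero]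
    intro v hv
    have h1 : (L.carrier _).mkQ v = 0 := by
      apply (h' i s hs hb).1
      refine Eq.trans ?_ (map_zero (L.quot.act s hb)).symm
      change (L.carrier b).mkQ (R.act s hb v) = 0
      rw [hv, map_zero]
    have h2 : v ∈ L.carrier _ := by simpa using h1
    have h3 : (⟨v, h2⟩ : L.carrier _) = 0 := by
      apply (h i s hs hb).1
      exact Subtype.ext (by change R.act s hb v = R.act s hb 0; rw [hv, map_zero])
    exact congrArg Subtype.val h3
  · intro w
    obtain ⟨v, hv⟩ := (h' i s hs hb).2 ((L.carrier _).mkQ w)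
    obtain ⟨v, rfl⟩ := (L.carrier _).mkQ_surjective v
    have h1 : w - R.act s hb v ∈ L.carrier b := by
      rw [← Submodule.Quotient.eq]
      exact hv.symm
    obtain ⟨v', hv'⟩ := (h i s hs hb).2 ⟨_, h1⟩
    have h2 : R.act s hb v'.1 = w - R.act s hb v := congrArg Subtype.val hv'
    exact ⟨v'.1 + v, by rw [map_add, h2, sub_add_cancel]⟩

theorem eq_of_isLevel {n : ℕ} (hn : 0 < n) {L L' : Sub R} (h : L.IsLevel n) (h' : L'.IsLevel n)
    (he : ∀ i : ℤ, L.carrier (vtx n i) = L'.carrier (vtx n i)) : L = L' := by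
  ext a v
  obtain ⟨i, s, hs, ha⟩ := exists_vtx n hn a
  constructor
  · intro hv
    obtain ⟨v, hv', rfl⟩ := h i s hs ha v hv
    exact L'.act_mem s ha v ((he i).le hv')
  · intro hv
    obtain ⟨v, hv', rfl⟩ := h' i s hs ha v hv
    exact L.act_mem s ha v ((he i).ge hv')

end Sub

theorem vtx_fin (n : ℕ) (hn : 0 < n) (i : ℤ) : ∃ j : Fin n, vtx n i = vtx n (j : ℕ) := by
  have hn' : (0 : ℚ) < n := by exact_mod_cast hn
  have hnz : (0 : ℤ) < n := by exact_mod_cast hn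
  have h1 : (i : ℚ) = n * ((i / (n : ℤ) : ℤ) : ℚ) + ((i % (n : ℤ) : ℤ) : ℚ) := by
    exact_mod_cast (Int.mul_ediv_add_emod i n).symm
  have h2 := Int.emod_nonneg i hnz.ne'
  have h3 := Int.emod_lt_of_pos i hnz
  refine ⟨⟨(i % (n : ℤ)).toNat, by omega⟩, ?_⟩
  have h4 : (((i % (n : ℤ)).toNat : ℕ) : ℤ) = i % (n : ℤ) := Int.toNat_of_nonneg h2
  simp only [h4]
  refine Eq.symm (QuotientAddGroup.eq.2 ⟨i / (n : ℤ), ?_⟩)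
  simp only [zsmul_eq_mul, mul_one]
  rw [h1]
  field_simp
  simp

theorem Sub.finite_level [Finite k] (R : TorSheaf k) {n : ℕ} (hn : 0 < n) :
    {L : Sub R | L.IsLevel n}.Finite := by
  have : ∀ a, Finite (Submodule k (R.V a)) := fun a => by
    have : Finite (R.V a) := Module.finite_of_finite k
    exact Finite.of_injective (fun L : Submodule k (R.V a) => (L : Set (R.V a)))
      SetLike.coe_injective
  refine Set.Finite.of_finite_image (f := fun L => fun j : Fin n => L.carrier (vtx n (j : ℕ)))
    (Set.toFinite _) ?_
  intro L hL L' hL' he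
  refine Sub.eq_of_isLevel hn hL hL' fun i => ?_
  obtain ⟨j, hj⟩ := vtx_fin n hn i
  rw [hj]
  exact congrFun he j

theorem act_pow {n : ℕ} {R R' : TorSheaf k} (φ : ∀ a, R.V a ≃ₗ[k] R'.V a)
    (hφ : ∀ (i : ℤ) {b : RatCircle} (h : b = vtx n i + pt (1 / n)) (v : R.V (vtx n i)),
      φ b (R.act (1 / n) h v) = R'.act (1 / n) h (φ _ v)) (m : ℕ) :
    ∀ (i : ℤ) (s : ℚ≥0), s = m / n → ∀ {b : RatCircle} (h : b = vtx n i + pt s)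
      (v : R.V (vtx n i)), φ b (R.act s h v) = R'.act s h (φ _ v) := by
  induction m with
  | zero =>
    intro i s hs b h v
    have hs0 : s = 0 := by simpa using hs
    subst hs0
    have hb : b = vtx n i := by rw [h, pt_zero, add_zero]
    subst hb
    rw [R.act_zero, R'.act_zero]
  | succ m ih =>
    intro i s hs b h v
    have hs' : s = m / n + 1 / n := by rw [hs]; push_cast; ring
    subst hs'
    have h1 : vtx n (i + m) = vtx n i + pt (m / n) := by
      simp only [vtx, pt]
      rw [← AddCircle.coe_add]; congr 1; push_cast; ring
    have h2 : b = vtx n (i + m) + pt (1 / n) := by rw [h, h1, pt_add, add_assoc]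
    rw [← R.act_add _ _ h1 h2 h v, hφ, ih i _ rfl h1 v, R'.act_add _ _ h1 h2 h]

theorem vtx_compare {n : ℕ} (hn : 0 < n) (i j : ℤ) (s t : ℚ≥0) (hs : s * n < 1)
    (h : vtx n i + pt s = vtx n j + pt t) :
    ∃ m : ℕ, t = m / n + s ∧ vtx n i = vtx n j + pt (m / n) := by
  have hn' : (0 : ℚ) < n := by exact_mod_cast hn
  simp only [vtx, pt, ← AddCircle.coe_add] at h
  obtain ⟨z, hz⟩ := QuotientAddGroup.eq.1 h
  simp only [zsmul_eq_mul, mul_one] at hz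
  have hs' : (s : ℚ) * n < 1 := by exact_mod_cast hs
  have ht : (0 : ℚ) ≤ t * n := by positivity
  have e1 : (((i - j + z * n : ℤ)) : ℚ) = (t - s) * n := by
    have : (t : ℚ) = z + i / n + s - j / n := by linarith
    rw [this]; push_cast; field_simp; ring
  have e2 : (-1 : ℚ) < ((i - j + z * n : ℤ) : ℚ) := by rw [e1, sub_mul]; linarith
  have e3 : (-1 : ℤ) < i - j + z * n := by exact_mod_cast e2
  obtain ⟨m, hm⟩ := Int.eq_ofNat_of_zero_le (show 0 ≤ i - j + z * n by omega)
  rw [hm] at e1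
  refine ⟨m, ?_, ?_⟩
  · rw [← NNRat.coe_inj]
    push_cast at e1 ⊢
    field_simp
    linarith
  · simp only [vtx, pt, ← AddCircle.coe_add]
    refine QuotientAddGroup.eq.2 ⟨z, ?_⟩
    have e4 : (m : ℚ) = i - j + z * n := by exact_mod_cast hm.symm
    simp only [zsmul_eq_mul, mul_one]
    push_cast
    rw [e4]; field_simp; ring

theorem iso_of_level {n : ℕ} (hn : 0 < n) {R R' : TorSheaf k} (hR : R.IsLevel n)
    (hR' : R'.IsLevel n) (φ : ∀ a, R.V a ≃ₗ[k] R'.V a)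
    (hφ : ∀ (i : ℤ) {b : RatCircle} (h : b = vtx n i + pt (1 / n)) (v : R.V (vtx n i)),
      φ b (R.act (1 / n) h v) = R'.act (1 / n) h (φ _ v)) : Nonempty (Iso R R') := by
  choose i s hs ha using exists_vtx n hn
  let A (a : RatCircle) := LinearEquiv.ofBijective _ (hR (i a) (s a) (hs a) (ha a))
  let A' (a : RatCircle) := LinearEquiv.ofBijective _ (hR' (i a) (s a) (hs a) (ha a))
  let ψ (a : RatCircle) : R.V a ≃ₗ[k] R'.V a := ((A a).symm.trans (φ _)).trans (A' a)
  have hψ : ∀ a v, ψ a (R.act (s a) (ha a) v) = R'.act (s a) (ha a) (φ _ v) := by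
    intro a v
    have h1 : (A a).symm (R.act (s a) (ha a) v) = v := (A a).symm_apply_apply v
    change A' a (φ _ ((A a).symm (R.act (s a) (ha a) v))) = _
    rw [h1]; rfl
  have key : ∀ (j : ℤ) (t : ℚ≥0) {b : RatCircle} (h : b = vtx n j + pt t) (v : R.V (vtx n j)),
      ψ b (R.act t h v) = R'.act t h (φ _ v) := by
    intro j t b h v
    obtain ⟨m, hm, h1⟩ := vtx_compare hn (i b) j (s b) t (hs b) ((ha b).symm.trans h)
    subst hm
    rw [← R.act_add _ _ h1 (ha b) h v, hψ, act_pow φ hφ m j _ rfl h1 v,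
      R'.act_add _ _ h1 (ha b) h]
  refine ⟨⟨ψ, fun t a b h v => ?_⟩⟩
  obtain ⟨w, rfl⟩ := (hR (i a) (s a) (hs a) (ha a)).2 v
  have h2 : b = vtx n (i a) + pt (s a + t) := by rw [h, pt_add, ← add_assoc, ← ha a]
  rw [R.act_add _ _ (ha a) h h2 w, key, hψ, R'.act_add _ _ (ha a) h h2]

/-- The isomorphism classes of torsion sheaves. -/
abbrev Cls (k : Type u) [Field k] : Type (u + 1) := Quotient (isoSetoid k)

/-- The isomorphism class of a torsion sheaf. -/
def cls (M : TorSheaf k) : Cls k := Quotient.mk _ M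

theorem cls_eq {M N : TorSheaf k} : M.cls = N.cls ↔ Nonempty (Iso M N) :=
  ⟨fun h => Quotient.exact h, fun h => Quotient.sound h⟩

theorem finite_cls [Finite k] {n : ℕ} (hn : 0 < n) (d : StepFun) :
    {c : Cls k | ∃ R : TorSheaf k, R.cls = c ∧ R.IsLevel n ∧ R.dim = d}.Finite := by
  let D (a : RatCircle) : ℕ := (d.1 a).toNat
  have : ∀ j : Fin n, Finite
      ((Fin (D (vtx n (j : ℕ))) → k) →ₗ[k] (Fin (D (vtx n ((j : ℕ) + 1 : ℤ))) → k)) := fun j =>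
    Finite.of_injective (fun f => (f : (Fin (D (vtx n (j : ℕ))) → k) → _)) DFunLike.coe_injective
  rw [Set.finite_coe_iff.symm]
  have hdim : ∀ R : TorSheaf k, R.dim = d → ∀ a, Module.finrank k (R.V a) = D a := by
    rintro R rfl a
    exact (Int.toNat_natCast _).symm
  choose R hRc hRl hRd using fun c : {c : Cls k | ∃ R : TorSheaf k, R.cls = c ∧ R.IsLevel n ∧
    R.dim = d} => c.2
  let e (c) (a : RatCircle) : (R c).V a ≃ₗ[k] (Fin (D a) → k) :=
    LinearEquiv.ofFinrankEq _ _ (by rw [hdim _ (hRd c)]; simp)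
  have hv : ∀ i : ℤ, vtx n (i + 1) = vtx n i + pt (1 / n) := fun i => by
    simp only [vtx, pt]
    rw [← AddCircle.coe_add]; congr 1; push_cast; ring
  refine Finite.of_injective (fun c => fun j : Fin n =>
    (e c _).toLinearMap ∘ₗ ((R c).act (1 / n) (hv (j : ℕ))) ∘ₗ (e c _).symm.toLinearMap) ?_
  intro c c' h
  apply Subtype.ext
  rw [← hRc c, ← hRc c', cls_eq]
  refine iso_of_level hn (hRl c) (hRl c') (fun a => (e c a).trans (e c' a).symm) ?_
  have main : ∀ (j : Fin n) (v : (R c).V (vtx n (j : ℕ))),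
      ((e c _).trans (e c' _).symm) ((R c).act (1 / n) (hv (j : ℕ)) v) =
        (R c').act (1 / n) (hv (j : ℕ)) (((e c _).trans (e c' _).symm) v) := by
    intro j v
    have h1 := LinearMap.congr_fun (congrFun h j) (e c _ v)
    simp only [LinearMap.comp_apply, LinearEquiv.coe_coe, LinearEquiv.symm_apply_apply] at h1
    rw [LinearEquiv.trans_apply, h1, LinearEquiv.symm_apply_apply]
    rfl
  intro i b hb v
  obtain ⟨j, hj⟩ := vtx_fin n hn i
  have gen : ∀ (a : RatCircle), a = vtx n (j : ℕ) → ∀ (b : RatCircle) (hb : b = a + pt (1 / n))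
      (v : (R c).V a), ((e c b).trans (e c' b).symm) ((R c).act (1 / n) hb v) =
        (R c').act (1 / n) hb (((e c a).trans (e c' a).symm) v) := by
    rintro a rfl b hb v
    have hb' : b = vtx n ((j : ℕ) + 1 : ℤ) := by rw [hb, hv]
    subst hb'
    exact main j v
  exact gen _ hj b hb v

theorem finsum_sigma_of_finite {α : Type*} {β : α → Type*} {M : Type*} [AddCommMonoid M]
    (F : (Σ a, β a) → M) (hF : (Function.support F).Finite) :
    ∑ᶠ p, F p = ∑ᶠ a, ∑ᶠ b, F ⟨a, b⟩ := by
  classical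
  let S : ∀ a, Finset (β a) := fun a =>
    (hF.preimage (sigma_mk_injective (i := a)).injOn).toFinset
  let T : Finset α := hF.toFinset.image Sigma.fst
  have h1 : ∑ᶠ p, F p = ∑ p ∈ T.sigma S, F p := by
    refine finsum_eq_sum_of_support_subset F ?_
    rintro ⟨a, b⟩ hp
    simp only [T, S, Finset.coe_sigma, Set.mem_sigma_iff, Finset.mem_coe, Finset.mem_image,
      Set.Finite.mem_toFinset, Set.mem_preimage]
    exact ⟨⟨_, hp, rfl⟩, hp⟩
  have h2 : ∀ a, ∑ᶠ b, F ⟨a, b⟩ = ∑ b ∈ S a, F ⟨a, b⟩ := fun a => by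
    refine finsum_eq_sum_of_support_subset _ ?_
    intro b hb
    simp only [S, Finset.mem_coe, Set.Finite.mem_toFinset, Set.mem_preimage]
    exact hb
  rw [h1, Finset.sum_sigma]
  simp only [h2]
  refine (finsum_eq_sum_of_support_subset _ ?_).symm
  intro a ha
  obtain ⟨b, -, hb⟩ := Finset.exists_ne_zero_of_sum_ne_zero ha
  simp only [T, Finset.mem_coe, Finset.mem_image, Set.Finite.mem_toFinset]
  exact ⟨⟨a, b⟩, hb, rfl⟩

/-- The isomorphism of sheaves given by a bijective morphism. -/
def Iso.ofBijective {M N : TorSheaf k} (φ : ∀ a, M.V a →ₗ[k] N.V a)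
    (hφ : ∀ a, Function.Bijective (φ a))
    (comm : ∀ (s : ℚ≥0) {a b : RatCircle} (h : b = a + pt s) (v : M.V a),
      φ b (M.act s h v) = N.act s h (φ a v)) : Iso M N :=
  ⟨fun a => LinearEquiv.ofBijective (φ a) (hφ a), comm⟩

namespace Sub

/-- The transport of a subsheaf along an isomorphism. -/
def map {R R' : TorSheaf k} (e : Iso R R') (L : Sub R) : Sub R' where
  carrier a := (L.carrier a).map (e.equiv a).toLinearMap
  act_mem s a b h v := by
    rintro ⟨v, hv, rfl⟩
    exact ⟨R.act s h v, L.act_mem s h v hv, e.comm s h v⟩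
  coherent := by
    obtain ⟨n, hn, h⟩ := L.coherent
    refine ⟨n, hn, fun i s hs b hb w => ?_⟩
    rintro ⟨w, hw, rfl⟩
    obtain ⟨v, hv, rfl⟩ := h i s hs hb w hw
    exact ⟨_, ⟨v, hv, rfl⟩, (e.comm s hb v).symm⟩

theorem map_symm_map {R R' : TorSheaf k} (e : Iso R R') (L : Sub R) :
    map e.symm (map e L) = L := by
  ext a v
  simp only [map, Iso.symm, Submodule.mem_map]
  constructor
  · rintro ⟨_, ⟨v, hv, rfl⟩, rfl⟩
    simpa using hv
  · intro hv
    exact ⟨_, ⟨v, hv, rfl⟩, by simp⟩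

/-- Isomorphic sheaves have the same subsheaves. -/
def mapEquiv {R R' : TorSheaf k} (e : Iso R R') : Sub R ≃ Sub R' :=
  ⟨map e, map e.symm, map_symm_map e, map_symm_map e.symm⟩

theorem obj_map {R R' : TorSheaf k} (e : Iso R R') (L : Sub R) :
    (map e L).obj.cls = L.obj.cls := by
  rw [eq_comm, cls_eq]
  exact ⟨⟨fun a => (e.equiv a).submoduleMap (L.carrier a),
    fun s a b h v => Subtype.ext (e.comm s h v.1)⟩⟩

theorem quot_map {R R' : TorSheaf k} (e : Iso R R') (L : Sub R) :
    (map e L).quot.cls = L.quot.cls := by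
  rw [eq_comm, cls_eq]
  refine ⟨⟨fun a => Submodule.Quotient.equiv _ _ (e.equiv a) rfl, fun s a b h v => ?_⟩⟩
  obtain ⟨v, rfl⟩ := (L.carrier a).mkQ_surjective v
  exact congrArg ((map e L).carrier b).mkQ (e.comm s h v)

theorem finite_cls [Finite k] (R : TorSheaf k) (c : Cls k) : {L : Sub R | L.obj.cls = c}.Finite := by
  obtain ⟨M, rfl⟩ := Quotient.exists_rep c
  obtain ⟨n, hn, h⟩ := M.exists_level
  refine (finite_level R hn).subset fun L hL => ?_
  obtain ⟨e⟩ := cls_eq.1 hL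
  exact isLevel_obj (h.iso e.symm)

theorem finite_supp [Finite k] (R : TorSheaf k) (g : Cls k →₀ Scalars k) :
    {L : Sub R | g L.obj.cls ≠ 0}.Finite := by
  refine (g.hasFiniteSupport.biUnion fun c _ => finite_cls R c).subset fun L hL => ?_
  simp only [Set.mem_iUnion]
  exact ⟨_, hL, rfl⟩

end Sub

/-- The Hall product of two functions, evaluated at a sheaf `R`:
`(f · g)(R) = ∑_{L ⊆ R} υ ^ ⟨R / L, L⟩ f(R / L) g(L)`. -/
def hallFun (f g : Cls k →₀ Scalars k) (R : TorSheaf k) : Scalars k :=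
  ∑ᶠ L : Sub R, ups k (eulerTor L.quot.dim L.obj.dim) * (f L.quot.cls * g L.obj.cls)

/-- The dimension of an isomorphism class. -/
def clsDim (c : Cls k) : StepFun := Quotient.lift dim (by rintro _ _ ⟨e⟩; exact dim_iso e) c

theorem clsDim_cls (M : TorSheaf k) : clsDim M.cls = M.dim := rfl

theorem hallFun_iso (f g : Cls k →₀ Scalars k) {R R' : TorSheaf k} (e : Iso R R') :
    hallFun f g R = hallFun f g R' := by
  unfold hallFun
  rw [← finsum_comp_equiv (Sub.mapEquiv e)]
  refine finsum_congr fun L => ?_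
  have h1 : (Sub.mapEquiv e L).obj.cls = L.obj.cls := Sub.obj_map e L
  have h2 : (Sub.mapEquiv e L).quot.cls = L.quot.cls := Sub.quot_map e L
  rw [← clsDim_cls, ← clsDim_cls, ← clsDim_cls (Sub.quot (Sub.mapEquiv e L)),
    ← clsDim_cls (Sub.obj (Sub.mapEquiv e L)), h1, h2]

theorem hallFun_finite [Finite k] (f g : Cls k →₀ Scalars k) (R : TorSheaf k) : (Function.support
    fun L : Sub R => ups k (eulerTor L.quot.dim L.obj.dim) * (f L.quot.cls * g L.obj.cls)).Finite := by
  refine (Sub.finite_supp R g).subset fun L hL h => hL ?_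
  simp only [h, mul_zero]

/-- The Hall product of two functions, evaluated at an isomorphism class. -/
def hallCls (f g : Cls k →₀ Scalars k) (c : Cls k) : Scalars k :=
  Quotient.lift (hallFun f g) (by rintro _ _ ⟨e⟩; exact hallFun_iso f g e) c

theorem hallCls_finite [Finite k] (f g : Cls k →₀ Scalars k) : (Function.support (hallCls f g)).Finite := by
  have key : ∀ A B : Cls k,
      {c : Cls k | ∃ (R : TorSheaf k) (L : Sub R), R.cls = c ∧ L.quot.cls = A ∧
        L.obj.cls = B}.Finite := by
    intro A B
    obtain ⟨M, rfl⟩ := Quotient.exists_rep A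
    obtain ⟨N, rfl⟩ := Quotient.exists_rep B
    obtain ⟨n, hn, hM⟩ := M.exists_level
    obtain ⟨m, hm, hN⟩ := N.exists_level
    refine (finite_cls (Nat.mul_pos hn hm) (M.dim + N.dim)).subset ?_
    rintro c ⟨R, L, rfl, hA, hB⟩
    obtain ⟨e⟩ := cls_eq.1 hA
    obtain ⟨e'⟩ := cls_eq.1 hB
    refine ⟨R, rfl, Sub.isLevel_ext (L := L) ?_ ?_, ?_⟩
    · exact (hN.mul' hn hm).iso e'.symm
    · exact (hM.mul hn hm).iso e.symm
    · rw [← L.dim_add, dim_iso e, dim_iso e']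
  refine (f.hasFiniteSupport.biUnion fun A _ => g.hasFiniteSupport.biUnion fun B _ =>
    key A B).subset fun c hc => ?_
  obtain ⟨R, rfl⟩ := Quotient.exists_rep c
  obtain ⟨L, hL⟩ : ∃ L : Sub R,
      ups k (eulerTor L.quot.dim L.obj.dim) * (f L.quot.cls * g L.obj.cls) ≠ 0 := by
    by_contra hcon
    push Not at hcon
    exact hc (finsum_eq_zero_of_forall_eq_zero hcon)
  simp only [Set.mem_iUnion]
  refine ⟨L.quot.cls, fun h => hL ?_, L.obj.cls, fun h => hL ?_, R, L, rfl, rfl, rfl⟩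
  · simp only [h, zero_mul, mul_zero]
  · simp only [h, mul_zero]

namespace Sub

variable {R : TorSheaf k}

/-- Two nested subsheaves. -/
def Flag (R : TorSheaf k) : Type u := {p : Sub R × Sub R // ∀ a, p.1.carrier a ≤ p.2.carrier a}

/-- The preimage in `R` of a subsheaf of `R / L`. -/
def comap (L : Sub R) (P : Sub L.quot) : Sub R where
  carrier a := Submodule.comap (L.carrier a).mkQ (P.carrier a)
  act_mem s _ _ h v hv := P.act_mem s h ((L.carrier _).mkQ v) hv
  coherent := by
    obtain ⟨n, hn, -, hL⟩ := L.exists_level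
    obtain ⟨m, hm, hP⟩ := P.coherent
    have hP' : P.IsLevel m := hP
    refine ⟨n * m, Nat.mul_pos hn hm, fun i s hs b hb w hw => ?_⟩
    obtain ⟨p, hp, he⟩ := hP'.mul' hn hm i s hs hb _ hw
    obtain ⟨v, rfl⟩ := (L.carrier _).mkQ_surjective p
    have h1 : w - R.act s hb v ∈ L.carrier b := by
      rw [← Submodule.Quotient.eq]
      exact he.symm
    obtain ⟨v', hv', hv''⟩ := hL.mul hn hm i s hs hb _ h1
    refine ⟨v' + v, ?_, by rw [map_add, hv'', sub_add_cancel]⟩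
    have h2 : (L.carrier _).mkQ (v' + v) = (L.carrier _).mkQ v := by
      rw [map_add, (LinearMap.mem_ker.1 (by simpa using hv') : (L.carrier _).mkQ v' = 0), zero_add]
    change (L.carrier _).mkQ (v' + v) ∈ P.carrier _
    rw [h2]
    exact hp

theorem le_comap (L : Sub R) (P : Sub L.quot) (a : RatCircle) :
    L.carrier a ≤ (L.comap P).carrier a := by
  intro v hv
  change (L.carrier a).mkQ v ∈ P.carrier a
  rw [(LinearMap.mem_ker.1 (by simpa using hv) : (L.carrier _).mkQ v = 0)]
  exact (P.carrier a).zero_mem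

/-- The image `N / L` of a subsheaf `N` in `R / L`. -/
def image (L N : Sub R) : Sub L.quot where
  carrier a := Submodule.map (L.carrier a).mkQ (N.carrier a)
  act_mem s a b h v := by
    rintro ⟨v, hv, rfl⟩
    exact ⟨R.act s h v, N.act_mem s h v hv, rfl⟩
  coherent := by
    obtain ⟨n, hn, h⟩ := N.coherent
    refine ⟨n, hn, fun i s hs b hb w => ?_⟩
    rintro ⟨w, hw, rfl⟩
    obtain ⟨v, hv, rfl⟩ := h i s hs hb w hw
    exact ⟨_, ⟨v, hv, rfl⟩, rfl⟩

/-- The image in `R` of a subsheaf of a subsheaf `N` of `R`. -/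
def push (N : Sub R) (Q : Sub N.obj) : Sub R where
  carrier a := Submodule.map (N.carrier a).subtype (Q.carrier a)
  act_mem s a b h v := by
    rintro ⟨v, hv, rfl⟩
    exact ⟨N.obj.act s h v, Q.act_mem s h v hv, rfl⟩
  coherent := by
    obtain ⟨n, hn, h⟩ := Q.coherent
    refine ⟨n, hn, fun i s hs b hb w => ?_⟩
    rintro ⟨w, hw, rfl⟩
    obtain ⟨v, hv, rfl⟩ := h i s hs hb w hw
    exact ⟨_, ⟨v, hv, rfl⟩, rfl⟩

theorem push_le (N : Sub R) (Q : Sub N.obj) (a : RatCircle) :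
    (N.push Q).carrier a ≤ N.carrier a := by
  rintro _ ⟨v, -, rfl⟩
  exact v.2

/-- A subsheaf `L` of `N`, as a subsheaf of the sheaf `N`. -/
def within (L N : Sub R) (hLN : ∀ a, L.carrier a ≤ N.carrier a) : Sub N.obj where
  carrier a := Submodule.comap (N.carrier a).subtype (L.carrier a)
  act_mem s _ _ h v hv := L.act_mem s h v.1 hv
  coherent := by
    obtain ⟨n, hn, h⟩ := L.coherent
    refine ⟨n, hn, fun i s hs b hb w hw => ?_⟩
    obtain ⟨v, hv, he⟩ := h i s hs hb w.1 hw
    exact ⟨⟨v, hLN _ hv⟩, hv, Subtype.ext he⟩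

/-- Subsheaves of `R / L` are subsheaves of `R` containing `L`. -/
def flagEquivQuot (R : TorSheaf k) : (Σ L : Sub R, Sub L.quot) ≃ Flag R where
  toFun p := ⟨(p.1, p.1.comap p.2), p.1.le_comap p.2⟩
  invFun p := ⟨p.1.1, p.1.1.image p.1.2⟩
  left_inv p := by
    refine Sigma.ext rfl (heq_of_eq ?_)
    ext a : 2
    exact Submodule.map_comap_eq_of_surjective (p.1.carrier a).mkQ_surjective _
  right_inv p := by
    refine Subtype.ext (Prod.ext rfl ?_)
    ext a : 2
    change Submodule.comap (p.1.1.carrier a).mkQ (Submodule.map _ _) = _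
    rw [Submodule.comap_map_mkQ]
    exact sup_eq_right.2 (p.2 a)

/-- Subsheaves of `N` are subsheaves of `R` contained in `N`. -/
def flagEquivSub (R : TorSheaf k) : (Σ N : Sub R, Sub N.obj) ≃ Flag R where
  toFun p := ⟨(p.1.push p.2, p.1), p.1.push_le p.2⟩
  invFun p := ⟨p.1.2, p.1.1.within p.1.2 p.2⟩
  left_inv p := by
    refine Sigma.ext rfl (heq_of_eq ?_)
    ext a : 2
    exact Submodule.comap_map_eq_of_injective (p.1.carrier a).injective_subtype _
  right_inv p := by
    refine Subtype.ext (Prod.ext ?_ rfl)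
    ext a : 2
    change Submodule.map (p.1.2.carrier a).subtype (Submodule.comap _ _) = _
    rw [Submodule.map_comap_subtype]
    exact inf_eq_right.2 (p.2 a)

theorem image_quot (L N : Sub R) (h : ∀ a, L.carrier a ≤ N.carrier a) :
    (L.image N).quot.cls = N.quot.cls := by
  rw [cls_eq]
  refine ⟨⟨fun a => Submodule.quotientQuotientEquivQuotient _ _ (h a), fun s a b hb v => ?_⟩⟩
  obtain ⟨v, rfl⟩ := ((L.image N).carrier a).mkQ_surjective v
  obtain ⟨v, rfl⟩ := (L.carrier a).mkQ_surjective v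
  rfl

theorem within_obj (L N : Sub R) (h : ∀ a, L.carrier a ≤ N.carrier a) :
    (L.within N h).obj.cls = L.obj.cls := by
  rw [cls_eq]
  exact ⟨⟨fun a => Submodule.submoduleOfEquivOfLe (h a), fun s a b hb v => rfl⟩⟩

theorem image_obj (L N : Sub R) (h : ∀ a, L.carrier a ≤ N.carrier a) :
    (L.image N).obj.cls = (L.within N h).quot.cls := by
  rw [eq_comm, cls_eq]
  let φ (a : RatCircle) : N.carrier a →ₗ[k] Submodule.map (L.carrier a).mkQ (N.carrier a) :=
    ((L.carrier a).mkQ.comp (N.carrier a).subtype).codRestrict _ fun v => ⟨v, v.2, rfl⟩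
  have hφ : ∀ a, LinearMap.ker (φ a) = (L.within N h).carrier a := fun a => by
    ext v
    rw [LinearMap.mem_ker, ← Subtype.coe_inj]
    change (L.carrier a).mkQ v = 0 ↔ v.1 ∈ L.carrier a
    simp
  refine ⟨Iso.ofBijective (fun a => Submodule.liftQ _ (φ a) (hφ a).ge) (fun a => ⟨?_, ?_⟩)
    fun s a b hb v => ?_⟩
  · exact LinearMap.ker_eq_bot.1 (Submodule.ker_liftQ_eq_bot _ _ _ (hφ a).le)
  · rintro ⟨_, v, hv, rfl⟩
    exact ⟨Submodule.Quotient.mk ⟨v, hv⟩, rfl⟩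
  · obtain ⟨v, rfl⟩ := ((L.within N h).carrier a).mkQ_surjective v
    rfl

end Sub

theorem hallFun_assoc [Finite k] (f g h fg gh : Cls k →₀ Scalars k)
    (hfg : ∀ R : TorSheaf k, fg R.cls = hallFun f g R)
    (hgh : ∀ R : TorSheaf k, gh R.cls = hallFun g h R) (R : TorSheaf k) :
    hallFun fg h R = hallFun f gh R := by
  let F : Sub.Flag R → Scalars k := fun p =>
    ups k (eulerTor p.1.2.quot.dim (p.1.1.within p.1.2 p.2).quot.dim +
      eulerTor p.1.2.quot.dim p.1.1.obj.dim +
      eulerTor (p.1.1.within p.1.2 p.2).quot.dim p.1.1.obj.dim) *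
      (f p.1.2.quot.cls * g (p.1.1.within p.1.2 p.2).quot.cls * h p.1.1.obj.cls)
  have e1 : ∀ p : Σ L : Sub R, Sub L.quot, F (Sub.flagEquivQuot R p) =
      ups k (eulerTor p.1.quot.dim p.1.obj.dim) *
        ((ups k (eulerTor p.2.quot.dim p.2.obj.dim) *
          (f p.2.quot.cls * g p.2.obj.cls)) * h p.1.obj.cls) := by
    intro p
    obtain ⟨p, rfl⟩ := (Sub.flagEquivQuot R).symm.surjective p
    rw [Equiv.apply_symm_apply]
    obtain ⟨⟨L, N⟩, hp⟩ := p
    change F _ = ups k (eulerTor L.quot.dim L.obj.dim) *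
        ((ups k (eulerTor (L.image N).quot.dim (L.image N).obj.dim) *
          (f (L.image N).quot.cls * g (L.image N).obj.cls)) * h L.obj.cls)
    have h1 := (L.image N).dim_add
    have h2 : (L.image N).quot.dim = N.quot.dim := by
      rw [← clsDim_cls, Sub.image_quot L N hp, clsDim_cls]
    have h3 : (L.image N).obj.dim = (L.within N hp).quot.dim := by
      rw [← clsDim_cls, Sub.image_obj L N hp, clsDim_cls]
    rw [Sub.image_quot L N hp, Sub.image_obj L N hp, ← h1, h2, h3, eulerTor_add_left]
    simp only [F, ups_add]
    ring
  have e2 : ∀ p : Σ N : Sub R, Sub N.obj, F (Sub.flagEquivSub R p) =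
      ups k (eulerTor p.1.quot.dim p.1.obj.dim) * (f p.1.quot.cls *
        (ups k (eulerTor p.2.quot.dim p.2.obj.dim) * (g p.2.quot.cls * h p.2.obj.cls))) := by
    intro p
    obtain ⟨p, rfl⟩ := (Sub.flagEquivSub R).symm.surjective p
    rw [Equiv.apply_symm_apply]
    obtain ⟨⟨L, N⟩, hp⟩ := p
    change F _ = ups k (eulerTor N.quot.dim N.obj.dim) * (f N.quot.cls *
        (ups k (eulerTor (L.within N hp).quot.dim (L.within N hp).obj.dim) *
          (g (L.within N hp).quot.cls * h (L.within N hp).obj.cls)))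
    have h1 := (L.within N hp).dim_add
    have h2 : (L.within N hp).obj.dim = L.obj.dim := by
      rw [← clsDim_cls, Sub.within_obj L N hp, clsDim_cls]
    rw [Sub.within_obj L N hp, ← h1, h2, eulerTor_add_right]
    simp only [F, ups_add]
    ring
  have hF : (Function.support F).Finite := by
    have h1 : (⋃ L ∈ {L : Sub R | h L.obj.cls ≠ 0}, (Sigma.mk L) ''
        {P : Sub L.quot | g P.obj.cls ≠ 0}).Finite :=
      (Sub.finite_supp R h).biUnion fun L _ => (Sub.finite_supp L.quot g).image _
    refine (h1.image (Sub.flagEquivQuot R)).subset fun p hp => ?_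
    obtain ⟨p, rfl⟩ := (Sub.flagEquivQuot R).surjective p
    refine ⟨p, ?_, rfl⟩
    have h2 : F _ ≠ 0 := hp
    rw [e1] at h2
    simp only [Set.mem_iUnion]
    refine ⟨p.1, fun h0 => h2 ?_, p.2, fun h0 => h2 ?_, rfl⟩
    · rw [h0, mul_zero, mul_zero]
    · rw [h0, mul_zero, mul_zero, zero_mul, mul_zero]
  have fin1 : (Function.support fun p => F (Sub.flagEquivQuot R p)).Finite :=
    hF.preimage (Sub.flagEquivQuot R).injective.injOn
  have fin2 : (Function.support fun p => F (Sub.flagEquivSub R p)).Finite :=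
    hF.preimage (Sub.flagEquivSub R).injective.injOn
  have l1 : hallFun fg h R = ∑ᶠ p, F p := by
    rw [← finsum_comp_equiv (Sub.flagEquivQuot R), finsum_sigma_of_finite _ fin1]
    refine finsum_congr fun L => ?_
    simp only [e1, hfg, hallFun]
    rw [finsum_mul' _ _ (hallFun_finite f g L.quot), mul_finsum']
    exact (hallFun_finite f g L.quot).subset fun P hP h0 => hP (by simp only [h0, zero_mul])
  have l2 : hallFun f gh R = ∑ᶠ p, F p := by
    rw [← finsum_comp_equiv (Sub.flagEquivSub R), finsum_sigma_of_finite _ fin2]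
    refine finsum_congr fun L => ?_
    simp only [e2, hgh, hallFun]
    rw [mul_finsum' _ _ (hallFun_finite g h L.obj), mul_finsum']
    exact (hallFun_finite g h L.obj).subset fun P hP h0 => hP (by simp only [h0, mul_zero])
  rw [l1, l2]

namespace Sub

variable {R : TorSheaf k}

/-- The whole sheaf, as a subsheaf. -/
def top (R : TorSheaf k) : Sub R where
  carrier _ := ⊤
  act_mem _ _ _ _ _ _ := trivial
  coherent := by
    obtain ⟨n, hn, h⟩ := R.coherent
    refine ⟨n, hn, fun i s hs b hb w _ => ?_⟩
    obtain ⟨v, hv⟩ := (h i s hs hb).2 w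
    exact ⟨v, trivial, hv⟩

/-- The zero subsheaf. -/
def bot (R : TorSheaf k) : Sub R where
  carrier _ := ⊥
  act_mem _ _ _ _ v hv := by
    rw [Submodule.mem_bot] at hv ⊢
    rw [hv, map_zero]
  coherent := ⟨1, one_pos, fun i s _ b hb w hw => ⟨0, Submodule.zero_mem _, by
    rw [Submodule.mem_bot] at hw
    rw [hw, map_zero]⟩⟩

theorem top_obj : (top R).obj.cls = R.cls :=
  cls_eq.2 ⟨⟨fun _ => Submodule.topEquiv, fun _ _ _ _ _ => rfl⟩⟩

theorem bot_quot : (bot R).quot.cls = R.cls := by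
  rw [eq_comm, cls_eq]
  exact ⟨⟨fun a => (Submodule.quotEquivOfEqBot _ rfl).symm, fun _ _ _ _ _ => rfl⟩⟩

theorem cls_eq_zero {M : TorSheaf k} : M.cls = (zero k).cls ↔ ∀ a, Subsingleton (M.V a) := by
  rw [cls_eq]
  constructor
  · rintro ⟨e⟩ a
    exact ⟨fun v w => (e.equiv a).injective rfl⟩
  · intro h
    refine ⟨⟨fun a => ⟨0, fun _ => 0, fun v => Subsingleton.elim _ _, fun v => rfl⟩,
      fun _ _ _ _ _ => rfl⟩⟩

theorem quot_zero {L : Sub R} : L.quot.cls = (zero k).cls ↔ L = top R := by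
  rw [cls_eq_zero]
  constructor
  · intro h
    ext a : 2
    exact Submodule.Quotient.subsingleton_iff.1 (h a)
  · rintro rfl a
    exact Submodule.Quotient.subsingleton_iff.2 rfl

theorem obj_zero {L : Sub R} : L.obj.cls = (zero k).cls ↔ L = bot R := by
  rw [cls_eq_zero]
  constructor
  · intro h
    ext a : 2
    exact (Submodule.subsingleton_iff_eq_bot).1 (h a)
  · rintro rfl a
    exact (Submodule.subsingleton_iff_eq_bot).2 rfl

end Sub

theorem dim_zero : (zero k).dim = 0 := by
  ext a
  exact congrArg Nat.cast (Module.finrank_zero_of_subsingleton (R := k) (M := PUnit.{u + 1}))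

theorem hallFun_one_left (g : Cls k →₀ Scalars k) (R : TorSheaf k) :
    hallFun (Finsupp.single (zero k).cls 1) g R = g R.cls := by
  classical
  unfold hallFun
  rw [finsum_eq_single _ (Sub.top R)]
  · have h : (Sub.top R).quot.cls = (zero k).cls := Sub.quot_zero.2 rfl
    rw [← clsDim_cls, h, clsDim_cls, dim_zero, eulerTor_zero_left, ups_zero, Sub.top_obj,
      Finsupp.single_eq_same, one_mul, one_mul]
  · intro L hL
    rw [Finsupp.single_eq_of_ne (fun h => hL (Sub.quot_zero.1 h)), zero_mul, mul_zero]

theorem hallFun_one_right (f : Cls k →₀ Scalars k) (R : TorSheaf k) :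
    hallFun f (Finsupp.single (zero k).cls 1) R = f R.cls := by
  classical
  unfold hallFun
  rw [finsum_eq_single _ (Sub.bot R)]
  · have h : (Sub.bot R).obj.cls = (zero k).cls := Sub.obj_zero.2 rfl
    rw [← clsDim_cls (Sub.obj _), h, clsDim_cls, dim_zero, eulerTor_zero_right, ups_zero,
      Sub.bot_quot, Finsupp.single_eq_same, one_mul, mul_one]
  · intro L hL
    rw [Finsupp.single_eq_of_ne (fun h => hL (Sub.obj_zero.1 h)), mul_zero, mul_zero]

theorem hallFun_add_left [Finite k] (f f' g : Cls k →₀ Scalars k) (R : TorSheaf k) :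
    hallFun (f + f') g R = hallFun f g R + hallFun f' g R := by
  unfold hallFun
  rw [← finsum_add_distrib (hallFun_finite f g R) (hallFun_finite f' g R)]
  refine finsum_congr fun L => ?_
  rw [Finsupp.add_apply]; ring

theorem hallFun_add_right [Finite k] (f g g' : Cls k →₀ Scalars k) (R : TorSheaf k) :
    hallFun f (g + g') R = hallFun f g R + hallFun f g' R := by
  unfold hallFun
  rw [← finsum_add_distrib (hallFun_finite f g R) (hallFun_finite f g' R)]
  refine finsum_congr fun L => ?_
  rw [Finsupp.add_apply]; ring

theorem hallFun_smul_left [Finite k] (c : Scalars k) (f g : Cls k →₀ Scalars k) (R : TorSheaf k) :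
    hallFun (c • f) g R = c * hallFun f g R := by
  unfold hallFun
  rw [mul_finsum' _ _ (hallFun_finite f g R)]
  refine finsum_congr fun L => ?_
  rw [Finsupp.smul_apply, smul_eq_mul]; ring

theorem hallFun_smul_right [Finite k] (c : Scalars k) (f g : Cls k →₀ Scalars k) (R : TorSheaf k) :
    hallFun f (c • g) R = c * hallFun f g R := by
  unfold hallFun
  rw [mul_finsum' _ _ (hallFun_finite f g R)]
  refine finsum_congr fun L => ?_
  rw [Finsupp.smul_apply, smul_eq_mul]; ring

end TorSheaf

open TorSheaf

/-- The Hall algebra of the category of torsion sheaves supported at the stacky point: the finitely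
supported functions on the set of isomorphism classes, with values in `Scalars k`. -/
def HallTor (k : Type u) [Field k] : Type (u + 1) := TorSheaf.Cls k →₀ Scalars k

namespace HallTor

variable {k : Type u} [Field k]

instance : AddCommGroup (HallTor k) := inferInstanceAs (AddCommGroup (TorSheaf.Cls k →₀ Scalars k))

instance : Module (Scalars k) (HallTor k) :=
  inferInstanceAs (Module (Scalars k) (TorSheaf.Cls k →₀ Scalars k))

/-- The value of an element of the Hall algebra at an isomorphism class. -/
def val (f : HallTor k) (c : TorSheaf.Cls k) : Scalars k :=
  DFunLike.coe (F := TorSheaf.Cls k →₀ Scalars k) f c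

theorem ext_cls {f g : HallTor k} (h : ∀ M : TorSheaf k, f.val M.cls = g.val M.cls) : f = g :=
  Finsupp.ext fun c => by
    obtain ⟨M, rfl⟩ := Quotient.exists_rep c
    exact h M

theorem val_add (f g : HallTor k) (c : TorSheaf.Cls k) : (f + g).val c = f.val c + g.val c := rfl

theorem val_smul (r : Scalars k) (f : HallTor k) (c : TorSheaf.Cls k) :
    (r • f).val c = r * f.val c := rfl

/-- The characteristic function `1_F` of (the isomorphism class of) a torsion sheaf `F`. -/
def char (F : TorSheaf k) : HallTor k := Finsupp.single F.cls (1 : Scalars k)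

instance : One (HallTor k) := ⟨char (TorSheaf.zero k)⟩

variable [Finite k]

/-- The product of the Hall algebra. -/
instance : Mul (HallTor k) :=
  ⟨fun f g => Finsupp.ofSupportFinite (TorSheaf.hallCls f g) (TorSheaf.hallCls_finite f g)⟩

theorem val_mul (f g : HallTor k) (R : TorSheaf k) :
    (f * g).val R.cls = TorSheaf.hallFun f g R := rfl

instance : Ring (HallTor k) :=
  { (inferInstance : AddCommGroup (HallTor k)),
    (inferInstance : Mul (HallTor k)), (inferInstance : One (HallTor k)) with
    left_distrib := fun f g h => ext_cls fun R => by
      rw [val_add]; exact hallFun_add_right f g h R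
    right_distrib := fun f g h => ext_cls fun R => by
      rw [val_add]; exact hallFun_add_left f g h R
    zero_mul := fun f => ext_cls fun R => by
      have h := hallFun_smul_left (0 : Scalars k) 0 f R
      rw [zero_mul] at h
      exact h
    mul_zero := fun f => ext_cls fun R => by
      have h := hallFun_smul_right (0 : Scalars k) f 0 R
      rw [zero_mul] at h
      exact h
    mul_assoc := fun f g h => ext_cls fun R =>
      hallFun_assoc f g h (f * g : HallTor k) (g * h : HallTor k) (fun _ => rfl) (fun _ => rfl) R
    one_mul := fun f => ext_cls fun R => hallFun_one_left f R
    mul_one := fun f => ext_cls fun R => hallFun_one_right f R }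

instance : Algebra (Scalars k) (HallTor k) :=
  Algebra.ofModule
    (fun r f g => ext_cls fun R => hallFun_smul_left r f g R)
    (fun r f g => ext_cls fun R => hallFun_smul_right r f g R)

end HallTor

section Extended

variable {k : Type u} [Field k] {genus : ℕ}

/-- The class in the numerical Grothendieck group of a torsion sheaf. -/
def clsNum (genus : ℕ) (c : TorSheaf.Cls k) : KNum genus := KNum.mk 0 (clsDim c)

/-- The factor `υ ^ (α, F)`. -/
def weight (α : KNum genus) (c : TorSheaf.Cls k) : Scalars k :=
  ups k (symEuler α (clsNum genus c))

theorem weight_add (α β : KNum genus) (c : TorSheaf.Cls k) :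
    weight (α + β) c = weight α c * weight β c := by
  rw [weight, symEuler_add_left, ups_add]; rfl

theorem weight_sub (α : KNum genus) {R : TorSheaf k} (L : Sub R) :
    weight α R.cls = weight α L.quot.cls * weight α L.obj.cls := by
  have h : clsNum genus R.cls = clsNum genus L.quot.cls + clsNum genus L.obj.cls := by
    refine Prod.ext (add_zero _).symm ?_
    exact L.dim_add.symm
  rw [weight, h, symEuler_add_right, ups_add]; rfl

theorem symEuler_zero_left (α : KNum genus) : symEuler 0 α = 0 := by
  simpa using symEuler_add_left 0 0 α

theorem symEuler_zero_right (α : KNum genus) : symEuler α 0 = 0 := by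
  simpa using symEuler_add_right α 0 0

/-- The multiplication of each `1_F` by `υ ^ (α, F)`. -/
def twist (α : KNum genus) (f : HallTor k) : HallTor k :=
  Finsupp.ofSupportFinite (fun c => weight α c * f.val c)
    ((Finsupp.hasFiniteSupport (M := Scalars k) f).subset fun c hc h => hc (by
      have h' : f.val c = 0 := h
      simp only [h', mul_zero]))

theorem val_twist (α : KNum genus) (f : HallTor k) (c : TorSheaf.Cls k) :
    (twist α f).val c = weight α c * f.val c := rfl

theorem val_one_of_ne {M : TorSheaf k} (h : M.cls ≠ (zero k).cls) :
    (1 : HallTor k).val M.cls = 0 := Finsupp.single_eq_of_ne h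

variable [Finite k]

/-- The action of the torus on the Hall algebra, for which `α` multiplies `1_F` by `υ ^ (α, F)`. -/
instance : MulSemiringAction (Multiplicative (KNum genus)) (HallTor k) where
  smul a f := twist a.toAdd f
  one_smul f := HallTor.ext_cls fun M => by
    change weight 0 M.cls * f.val M.cls = _
    rw [weight, symEuler_zero_left, ups_zero, one_mul]
  mul_smul a b f := HallTor.ext_cls fun M => by
    change weight (a.toAdd + b.toAdd) M.cls * f.val M.cls =
      weight a.toAdd M.cls * (weight b.toAdd M.cls * f.val M.cls)
    rw [weight_add, mul_assoc]
  smul_zero a := HallTor.ext_cls fun M => mul_zero (weight a.toAdd M.cls)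
  smul_add a f g := HallTor.ext_cls fun M => mul_add (weight a.toAdd M.cls) _ _
  smul_one a := HallTor.ext_cls fun M => by
    change weight a.toAdd M.cls * (1 : HallTor k).val M.cls = _
    by_cases h : M.cls = (zero k).cls
    · have h1 : clsNum genus (zero k).cls = 0 := Prod.ext rfl dim_zero
      rw [h, weight, h1, symEuler_zero_right, ups_zero, one_mul]
    · rw [val_one_of_ne h, mul_zero]
  smul_mul a f g := HallTor.ext_cls fun R => by
    change weight a.toAdd R.cls * hallFun f g R =
      hallFun (twist a.toAdd f) (twist a.toAdd g) R
    unfold hallFun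
    rw [mul_finsum' _ _ (hallFun_finite f g R)]
    refine finsum_congr fun L => ?_
    rw [weight_sub a.toAdd L]
    change _ = _ * ((weight a.toAdd L.quot.cls * f.val L.quot.cls) *
      (weight a.toAdd L.obj.cls * g.val L.obj.cls))
    change _ * (_ * (f.val L.quot.cls * g.val L.obj.cls)) = _
    ring

end Extended

/-- The extended Hall algebra of the category of torsion sheaves supported at the stacky point: the
semidirect product of the Hall algebra and the group algebra of the numerical Grothendieck group,
in which `k_α 1_F k_α⁻¹ = υ ^ (α, F) 1_F`. -/
def HallTw (k : Type u) [Field k] [Finite k] (genus : ℕ) : Type (u + 1) :=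
  SkewMonoidAlgebra (HallTor k) (Multiplicative (KNum genus))

namespace HallTw

variable {k : Type u} [Field k] [Finite k] {genus : ℕ}

instance : Ring (HallTw k genus) :=
  inferInstanceAs (Ring (SkewMonoidAlgebra (HallTor k) (Multiplicative (KNum genus))))

instance : Module (Scalars k) (HallTw k genus) :=
  inferInstanceAs (Module (Scalars k)
    (SkewMonoidAlgebra (HallTor k) (Multiplicative (KNum genus))))

/-- The element `f k_α`. -/
def mk (f : HallTor k) (α : KNum genus) : HallTw k genus :=
  SkewMonoidAlgebra.single (Multiplicative.ofAdd α) f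

/-- The element `k_α` of the extended Hall algebra. -/
def kk (α : KNum genus) : HallTw k genus := mk 1 α

theorem mk_mul_mk (f g : HallTor k) (α β : KNum genus) :
    mk f α * mk g β = mk (f * twist α g) (α + β) :=
  SkewMonoidAlgebra.single_mul_single

theorem smul_mk (r : Scalars k) (f : HallTor k) (α : KNum genus) :
    r • mk f α = mk (r • f) α :=
  SkewMonoidAlgebra.smul_single _ _ _

@[elab_as_elim]
theorem induction {p : HallTw k genus → Prop} (x : HallTw k genus) (h0 : p 0)
    (hadd : ∀ x y, p x → p y → p (x + y)) (hmk : ∀ f α, p (mk f α)) : p x :=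
  SkewMonoidAlgebra.induction_on x h0 (fun a f => hmk f a.toAdd) hadd

theorem twist_smul (r : Scalars k) (f : HallTor k) (α : KNum genus) :
    twist α (r • f) = r • twist α f :=
  HallTor.ext_cls fun M => by
    rw [HallTor.val_smul, val_twist, val_twist, HallTor.val_smul]; ring

theorem smul_mul (r : Scalars k) (x y : HallTw k genus) : r • x * y = r • (x * y) := by
  induction x using induction with
  | h0 => simp
  | hadd x x' hx hx' => rw [smul_add, add_mul, add_mul, smul_add, hx, hx']
  | hmk f α =>
    induction y using induction with
    | h0 => simp
    | hadd y y' hy hy' => rw [mul_add, mul_add, smul_add, hy, hy']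
    | hmk g β => rw [smul_mk, mk_mul_mk, mk_mul_mk, smul_mk, smul_mul_assoc]

theorem mul_smul' (r : Scalars k) (x y : HallTw k genus) : x * r • y = r • (x * y) := by
  induction x using induction with
  | h0 => simp
  | hadd x x' hx hx' => rw [add_mul, add_mul, smul_add, hx, hx']
  | hmk f α =>
    induction y using induction with
    | h0 => simp
    | hadd y y' hy hy' => rw [smul_add, mul_add, mul_add, smul_add, hy, hy']
    | hmk g β => rw [smul_mk, mk_mul_mk, mk_mul_mk, smul_mk, twist_smul, mul_smul_comm]

instance : Algebra (Scalars k) (HallTw k genus) := Algebra.ofModule smul_mul mul_smul'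

/-- The defining relation `k_α 1_F k_α⁻¹ = υ ^ (α, F) 1_F`. -/
theorem kk_conj (α : KNum genus) (F : TorSheaf k) :
    kk α * mk (HallTor.char F) 0 * kk (-α) =
      ups k (symEuler α (clsNum genus F.cls)) • mk (HallTor.char F) 0 := by
  have h1 : twist (α + 0) (1 : HallTor k) = 1 :=
    smul_one (Multiplicative.ofAdd (α + 0))
  rw [kk, kk, mk_mul_mk, mk_mul_mk, smul_mk, h1, one_mul, mul_one, add_zero, add_neg_cancel]
  congr 1
  refine HallTor.ext_cls fun M => ?_
  rw [val_twist, HallTor.val_smul]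
  by_cases h : M.cls = F.cls
  · rw [h]; rfl
  · have h2 : (HallTor.char F).val M.cls = 0 := Finsupp.single_eq_of_ne h
    rw [h2, mul_zero, mul_zero]

end HallTw

/-- The constant function `1` on the rational circle. -/
def constOne : StepFun := ⟨fun _ => 1, 1, one_pos, fun _ _ _ _ => rfl⟩

/-- The class `δ = (0, 1)` of the torsion sheaves of degree one supported at an ordinary
rational point. -/
def deltaClass (genus : ℕ) : KNum genus := KNum.mk 0 constOne

end InfiniteRootHall

end

/-!
The center of the Hall algebra is computed with one family of extensions; no classification of the
torsion sheaves is needed.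

Let `f` be an element of the Hall algebra with `1_N f ∈ Scalars k · f 1_N` for all `N`, and suppose
that `f M ≠ 0` for some `M ≠ 0`. Choose `n` such that all sheaves in the support of `f` come from
the `n`-th root stack. As `M` is nilpotent, it needs a generator `m` at some vertex `c = i / n`. Let `S`
be the simple sheaf of level `2 n` on the arc `[c - 1 / (2 n), c[`, and let `R` be the extension of
`S` by `M` in which the generator `g` of `S` satisfies `x ^ (1 / (2 n)) g = m` (`simpleExt`). The
sheaf `S` has no fibre at the vertices of the coarse subdivision, so that
* `M` is the only subsheaf of level `n` of `R` with quotient `S` (`eq_simpleExtSub`), and the value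
  of `1_S f` at `R` is a power of `υ` times `f M`;
* no subsheaf of `R` that is isomorphic to `S` has a quotient of level `n` (`simpleExt_no_sub`), and
  the value of `f 1_S` at `R` is zero.

This is a contradiction, so `f` is a multiple of `1` (`HallTor.eq_smul_one_of_comm_char`). It is
essential that `S` exists on a finer root stack: for a fixed `n`, the Hall algebra of the cyclic
quiver has a large center.

In the extended algebra, let `x = ∑ f_α k_α` be central. Commutation with `1_N` says that
`1_N f_α = υ ^ (α, N) f_α 1_N`, hence that `f_α` is a scalar `c`, with `c (υ ^ (α, N) - 1) = 0` for
all `N`. If `c ≠ 0`, then `(α, N) = 0` for all `N`, since `υ ^ m - 1` is a unit for `m ≠ 0`. The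
symmetrised Euler form is `∑_x Df(x) Dg(x)` on torsion classes, where `D` is the jump
(`eulerTor_add_eulerTor`), and testing it on the sheaves `S` shows that `α` is a multiple of `δ`
(`eq_zsmul_deltaClass`).
-/

open Filter Topology

noncomputable section

namespace InfiniteRootHall

universe u

/-! ### Arcs on the rational circle -/

/-- The length in `(0, 1]` of the positively oriented arc from `a` to `c`. -/
def gap (c a : RatCircle) : ℚ≥0 :=
  ⟨(AddCircle.equivIoc (1 : ℚ) 0 (c - a)).1, (AddCircle.equivIoc (1 : ℚ) 0 (c - a)).2.1.le⟩

theorem gap_pos (c a : RatCircle) : 0 < gap c a :=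
  (AddCircle.equivIoc (1 : ℚ) 0 (c - a)).2.1

theorem gap_le_one (c a : RatCircle) : gap c a ≤ 1 := by
  have h := (AddCircle.equivIoc (1 : ℚ) 0 (c - a)).2.2
  exact h.trans_eq (zero_add 1)

theorem eq_add_pt_gap (c a : RatCircle) : c = a + pt (gap c a) := by
  have h : pt (gap c a) = c - a := (AddCircle.equivIoc (1 : ℚ) 0).symm_apply_apply (c - a)
  rw [h, add_sub_cancel]

theorem gap_eq {c a : RatCircle} {r : ℚ≥0} (h0 : 0 < r) (h1 : r ≤ 1) (h : c = a + pt r) :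
    gap c a = r := by
  have h2 : (r : ℚ) ∈ Set.Ioc (0 : ℚ) (0 + 1) := by
    rw [zero_add]
    exact ⟨by exact_mod_cast h0, by exact_mod_cast h1⟩
  have h3 := (AddCircle.equivIoc (1 : ℚ) 0).apply_symm_apply ⟨r, h2⟩
  have h4 : (AddCircle.equivIoc (1 : ℚ) 0).symm ⟨r, h2⟩ = c - a := by
    rw [h, add_sub_cancel_left]; rfl
  rw [h4] at h3
  have h5 : (AddCircle.equivIoc (1 : ℚ) 0 (c - a)).1 = r := by rw [h3]
  exact NNRat.coe_injective h5

theorem gap_add {c a b : RatCircle} {s : ℚ≥0} (hs : s < gap c a) (h : b = a + pt s) :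
    gap c b + s = gap c a := by
  have h1 : gap c b = gap c a - s := by
    refine gap_eq (tsub_pos_of_lt hs) (tsub_le_self.trans (gap_le_one c a)) ?_
    rw [h, add_assoc, ← pt_add, add_tsub_cancel_of_le hs.le]
    exact eq_add_pt_gap c a
  rw [h1, tsub_add_cancel_of_le hs.le]

theorem eq_add_pt_sub_gap {c a b : RatCircle} {s : ℚ≥0} (hs : gap c a ≤ s) (h : b = a + pt s) :
    b = c + pt (s - gap c a) := by
  have h1 : c + pt (s - gap c a) = (a + pt (gap c a)) + pt (s - gap c a) :=
    congrArg (· + _) (eq_add_pt_gap c a)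
  rw [h1, add_assoc, ← pt_add, add_tsub_cancel_of_le hs, h]

/-- The arc between two vertices of the `n`-subdivision has a length in `(1 / n) ℕ`. -/
theorem exists_gap_vtx {n : ℕ} (hn : 0 < n) (i j : ℤ) :
    ∃ m : ℕ, 0 < m ∧ gap (vtx n j) (vtx n i) = m / n := by
  obtain ⟨m, hm, -⟩ := TorSheaf.vtx_compare hn j i 0 (gap (vtx n j) (vtx n i)) (by simp)
    (by rw [pt_zero, add_zero]; exact eq_add_pt_gap _ _)
  have hm' : gap (vtx n j) (vtx n i) = m / n := by simpa using hm
  refine ⟨m, Nat.pos_of_ne_zero fun h0 => ?_, hm'⟩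
  have h1 := gap_pos (vtx n j) (vtx n i)
  rw [hm', h0] at h1
  simp at h1

theorem vtx_add_one (n : ℕ) (i : ℤ) : vtx n (i + 1) = vtx n i + pt (1 / n) := by
  simp only [vtx, pt]
  rw [← AddCircle.coe_add]; congr 1; push_cast; ring

theorem vtx_sub_one (n : ℕ) (i : ℤ) : vtx n i = vtx n (i - 1) + pt (1 / n) := by
  rw [← vtx_add_one, sub_add_cancel]

theorem vtx_mul_two {n : ℕ} (i : ℤ) : vtx (n * 2) (i * 2) = vtx n i := by
  simp only [vtx]; congr 1; push_cast; exact mul_div_mul_right _ _ two_ne_zero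

/-! ### Extensions of simple sheaves -/

namespace TorSheaf

variable {k : Type u} [Field k]

/-- The fibre at `a` of the simple sheaf whose support is the arc `[c - ε, c[`. -/
def arc (k : Type u) [Field k] (c : RatCircle) (ε : ℚ≥0) (a : RatCircle) : Submodule k k :=
  if gap c a ≤ ε then ⊤ else ⊥

theorem arc_of_le {c : RatCircle} {ε : ℚ≥0} {a : RatCircle} (h : gap c a ≤ ε) :
    arc k c ε a = ⊤ := if_pos h

theorem arc_of_lt {c : RatCircle} {ε : ℚ≥0} {a : RatCircle} (h : ε < gap c a) :
    arc k c ε a = ⊥ := if_neg h.not_ge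

theorem arc_mono {c a b : RatCircle} {ε s : ℚ≥0} (hs : s < gap c a) (h : b = a + pt s) :
    arc k c ε a ≤ arc k c ε b := by
  rcases le_or_gt (gap c a) ε with h1 | h1
  · rw [arc_of_le (a := b)]
    · exact le_top
    · exact (le_self_add.trans (gap_add hs h).le).trans h1
  · rw [arc_of_lt h1]
    exact bot_le

/-- The multiplication by `x ^ s` in the extension of an arc by `M` in which the generator `g` of
the arc `[c - ε, c[` satisfies `x ^ ε g = m`. A path that stays before `c` acts on both factors
separately; one that reaches `c` sends the element `t` of the arc to `t x ^ (s - gap c a) m`. -/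
def extAct (M : TorSheaf k) (c : RatCircle) (ε : ℚ≥0) (m : M.V c) (s : ℚ≥0) {a b : RatCircle}
    (h : b = a + pt s) : (M.V a × arc k c ε a) →ₗ[k] (M.V b × arc k c ε b) :=
  if hs : s < gap c a then (M.act s h).prodMap (Submodule.inclusion (arc_mono hs h))
  else LinearMap.prod ((M.act s h).coprod ((LinearMap.toSpanSingleton k (M.V b)
    (M.act (s - gap c a) (eq_add_pt_sub_gap (not_lt.1 hs) h) m)).comp (arc k c ε a).subtype)) 0

variable {M : TorSheaf k} {c : RatCircle} {ε : ℚ≥0} {m : M.V c}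

theorem extAct_of_lt {s : ℚ≥0} {a b : RatCircle} (hs : s < gap c a) (h : b = a + pt s)
    (v : M.V a × arc k c ε a) :
    extAct M c ε m s h v = (M.act s h v.1, ⟨v.2.1, arc_mono hs h v.2.2⟩) := by
  rw [extAct, dif_pos hs]; rfl

theorem extAct_of_le {s : ℚ≥0} {a b : RatCircle} (hs : gap c a ≤ s) (h : b = a + pt s)
    (v : M.V a × arc k c ε a) :
    extAct M c ε m s h v =
      (M.act s h v.1 + v.2.1 • M.act (s - gap c a) (eq_add_pt_sub_gap hs h) m, 0) := by
  rw [extAct, dif_neg hs.not_gt]; rfl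

theorem act_eq_zero_of_le {N : ℕ} (hN : ∀ {a b : RatCircle} (h : b = a + pt N) (v : M.V a),
    M.act N h v = 0) {s : ℚ≥0} (hs : N ≤ s) {a b : RatCircle} (h : b = a + pt s) (v : M.V a) :
    M.act s h v = 0 := by
  obtain ⟨t, rfl⟩ := exists_add_of_le hs
  have h2 : b = (a + pt N) + pt t := by rw [h, pt_add, add_assoc]
  rw [← M.act_add _ _ rfl h2 h, hN, map_zero]

theorem extAct_bijective {n : ℕ} (hn : 0 < n) (hM : M.IsLevel n) (j : ℤ) (m : M.V (vtx n j))
    (i : ℤ) (s : ℚ≥0) (hs : s * n < 1) {b : RatCircle} (h : b = vtx n i + pt s) :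
    Function.Bijective (extAct M (vtx n j) (1 / n) m s h) := by
  have hn' : (0 : ℚ≥0) < n := by exact_mod_cast hn
  obtain ⟨r, hr0, hr⟩ := exists_gap_vtx hn i j
  have hs' : s < 1 / n := by rwa [lt_div_iff₀ hn']
  have hlt : s < gap (vtx n j) (vtx n i) := by
    rw [hr]
    refine hs'.trans_le ?_
    gcongr
    exact_mod_cast hr0
  -- A vertex outside of the arc stays outside of it under a translation by less than `1 / n`.
  have harc : arc k (vtx n j) (1 / n) b ≤ arc k (vtx n j) (1 / n) (vtx n i) := by
    rcases le_or_gt (gap (vtx n j) (vtx n i)) (1 / n) with h1 | h1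
    · rw [arc_of_le h1]; exact le_top
    · rw [arc_of_lt (a := b)]
      · exact bot_le
      · have h2 : (2 : ℚ≥0) / n ≤ gap (vtx n j) (vtx n i) := by
          rw [hr] at h1 ⊢
          have h3 : 1 < r := by
            have := (div_lt_div_iff_of_pos_right hn').1 h1
            exact_mod_cast this
          gcongr
          exact_mod_cast h3
        have h4 := gap_add hlt h
        by_contra h5
        have h6 : gap (vtx n j) (vtx n i) < 1 / n + 1 / n := by
          rw [← h4]; exact add_lt_add_of_le_of_lt (not_lt.1 h5) hs'
        rw [← add_div, one_add_one_eq_two] at h6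
        exact absurd h2 h6.not_ge
  constructor
  · intro v w hvw
    rw [extAct_of_lt hlt, extAct_of_lt hlt] at hvw
    obtain ⟨h1, h2⟩ := Prod.mk.inj hvw
    exact Prod.ext ((hM i s hs h).1 h1) (Subtype.ext (Subtype.mk.inj h2))
  · rintro ⟨w, t⟩
    obtain ⟨v, hv⟩ := (hM i s hs h).2 w
    refine ⟨(v, ⟨t.1, harc t.2⟩), ?_⟩
    rw [extAct_of_lt hlt, hv]

/-- The extension `R` of the simple sheaf with support `[c - 1 / n, c[` by a sheaf `M` of level `n`
in which the generator `g` of the simple sheaf satisfies `x ^ (1 / n) g = m`, for a given element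
`m` of the fibre of `M` at the vertex `c`. As a graded space it is the direct sum of both. -/
def simpleExt (M : TorSheaf k) {n : ℕ} (hn : 0 < n) (hM : M.IsLevel n) (j : ℤ)
    (m : M.V (vtx n j)) : TorSheaf k where
  V a := M.V a × arc k (vtx n j) (1 / n) a
  act s a b h := extAct M (vtx n j) (1 / n) m s h
  act_zero {a} h v := by
    rw [extAct_of_lt (gap_pos _ _), M.act_zero]
  act_add s t {a b c'} h h' h'' v := by
    rcases lt_or_ge s (gap (vtx n j) a) with hs | hs
    · have h1 := gap_add hs h
      rw [extAct_of_lt hs]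
      rcases lt_or_ge (s + t) (gap (vtx n j) a) with hst | hst
      · have ht : t < gap (vtx n j) b := by
          rw [← h1, add_comm s] at hst
          exact lt_of_add_lt_add_right hst
        rw [extAct_of_lt ht, extAct_of_lt hst, M.act_add s t h h' h'']
      · have ht : gap (vtx n j) b ≤ t := by
          rw [← h1, add_comm s] at hst
          exact le_of_add_le_add_right hst
        rw [extAct_of_le ht, extAct_of_le hst, M.act_add s t h h' h'']
        have h2 : s + t - gap (vtx n j) a = t - gap (vtx n j) b := by
          rw [← h1, add_comm s, add_tsub_add_eq_tsub_right]
        simp only [h2]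
    · have hst : gap (vtx n j) a ≤ s + t := hs.trans le_self_add
      rw [extAct_of_le hs, extAct_of_le hst, ← M.act_add s t h h' h'']
      have h2 : s + t - gap (vtx n j) a = (s - gap (vtx n j) a) + t :=
        (tsub_add_eq_add_tsub hs).symm
      have h3 : c' = vtx n j + pt ((s - gap (vtx n j) a) + t) := by
        rw [← h2]; exact eq_add_pt_sub_gap hst h''
      have h4 : M.act (s + t - gap (vtx n j) a) (eq_add_pt_sub_gap hst h'') m =
          M.act t h' (M.act (s - gap (vtx n j) a) (eq_add_pt_sub_gap hs h) m) := by
        rw [M.act_add _ _ _ h' h3]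
        simp only [h2]
      rw [h4, ← map_smul (M.act t h'), ← map_add]
      rcases lt_or_ge t (gap (vtx n j) b) with ht | ht
      · rw [extAct_of_lt ht]; rfl
      · rw [extAct_of_le ht]; simp
  nilpotent := by
    obtain ⟨N, hN⟩ := M.nilpotent
    refine ⟨N + 1, fun {a b} h v => ?_⟩
    have h1 := gap_le_one (vtx n j) a
    have h2 : gap (vtx n j) a ≤ (N + 1 : ℕ) := h1.trans (by simp)
    have h3 : (N : ℚ≥0) ≤ (N + 1 : ℕ) - gap (vtx n j) a := by
      rw [le_tsub_iff_right h2]; push_cast; gcongr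
    rw [extAct_of_le h2, act_eq_zero_of_le hN (by simp), act_eq_zero_of_le hN h3]
    simp
  coherent := ⟨n, hn, fun i s hs _ h => extAct_bijective hn hM j m i s hs h⟩

/-- The subsheaf `M` of an extension of a simple sheaf by `M`. -/
def simpleExtSub (M : TorSheaf k) {n : ℕ} (hn : 0 < n) (hM : M.IsLevel n) (j : ℤ)
    (m : M.V (vtx n j)) : Sub (simpleExt M hn hM j m) where
  carrier a := Submodule.prod ⊤ ⊥
  act_mem s a b h v hv := by
    have h0 : v.2 = 0 := hv.2
    refine ⟨trivial, ?_⟩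
    change (extAct M (vtx n j) (1 / n) m s h v).2 = 0
    rcases lt_or_ge s (gap (vtx n j) a) with hs | hs
    · refine (congrArg Prod.snd (extAct_of_lt hs h v)).trans ?_
      have h1 : v.2.1 = 0 := congrArg Subtype.val h0
      exact Subtype.ext h1
    · exact congrArg Prod.snd (extAct_of_le hs h v)
  coherent := by
    refine ⟨n, hn, fun i s hs b h w hw => ?_⟩
    obtain ⟨v, hv⟩ := (hM i s hs h).2 w.1
    have h0 : w.2 = 0 := hw.2
    refine ⟨(v, 0), ⟨trivial, rfl⟩, ?_⟩
    change extAct M (vtx n j) (1 / n) m s h (v, 0) = w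
    rcases lt_or_ge s (gap (vtx n j) (vtx n i)) with hs | hs
    · rw [extAct_of_lt hs]
      exact Prod.ext hv (h0 ▸ rfl)
    · rw [extAct_of_le hs]
      exact Prod.ext (by simpa using hv) h0.symm

section

variable {n : ℕ} (hn : 0 < n) (hM : M.IsLevel n) (j : ℤ) (m : M.V (vtx n j))

theorem simpleExt_isLevel : (simpleExt M hn hM j m).IsLevel n := fun i s hs _ h =>
  extAct_bijective hn hM j m i s hs h

theorem simpleExtSub_act {s : ℚ≥0} {a b : RatCircle} (h : b = a + pt s) (v : M.V a) :
    (simpleExt M hn hM j m).act s h (v, 0) = (M.act s h v, 0) := by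
  change extAct M (vtx n j) (1 / n) m s h (v, 0) = _
  rcases lt_or_ge s (gap (vtx n j) a) with hs | hs
  · rw [extAct_of_lt hs]; rfl
  · rw [extAct_of_le hs]; simp

theorem simpleExtSub_obj : (simpleExtSub M hn hM j m).obj.cls = M.cls := by
  rw [eq_comm, cls_eq]
  refine ⟨Iso.ofBijective
    (fun a => LinearMap.codRestrict (Submodule.prod ⊤ ⊥) (LinearMap.inl k _ _)
      fun v => ⟨trivial, rfl⟩)
    (fun a => ⟨fun v w hvw => congrArg Prod.fst (congrArg Subtype.val hvw), ?_⟩) ?_⟩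
  · rintro ⟨⟨v, t⟩, ht⟩
    have h0 : t = 0 := ht.2
    subst h0
    exact ⟨v, rfl⟩
  · intro s a b h v
    exact Subtype.ext (simpleExtSub_act hn hM j m h v).symm

/-- The dimension of the simple quotient is the characteristic function of the arc. -/
theorem simpleExtSub_quot_dim (a : RatCircle) :
    (simpleExtSub M hn hM j m).quot.dim.1 a = if gap (vtx n j) a ≤ 1 / n then 1 else 0 := by
  have h1 := congrFun (congrArg Subtype.val (simpleExtSub M hn hM j m).dim_add) a
  have h2 : (simpleExtSub M hn hM j m).obj.dim = M.dim := by
    rw [← clsDim_cls, simpleExtSub_obj, clsDim_cls]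
  rw [h2] at h1
  have h3 : (simpleExt M hn hM j m).dim.1 a =
      M.dim.1 a + (Module.finrank k (arc k (vtx n j) (1 / n) a) : ℤ) := by
    change ((Module.finrank k (M.V a × arc k (vtx n j) (1 / n) a) : ℕ) : ℤ) = _
    rw [Module.finrank_prod, Nat.cast_add]; rfl
  rw [h3] at h1
  have h4 : (simpleExtSub M hn hM j m).quot.dim.1 a =
      (Module.finrank k (arc k (vtx n j) (1 / n) a) : ℤ) := by
    have h5 : (simpleExtSub M hn hM j m).quot.dim.1 a + M.dim.1 a = _ := h1
    linarith
  rw [h4]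
  split_ifs with h
  · rw [arc_of_le h, finrank_top, Module.finrank_self]; rfl
  · rw [arc_of_lt (not_le.1 h), finrank_bot]; rfl

end

/-! ### Generators and levels -/

theorem surjective_act_vtx {M : TorSheaf k} {n : ℕ}
    (h : ∀ (i : ℤ) {a : RatCircle} (ha : vtx n i = a + pt (1 / n)),
      Function.Surjective (M.act (1 / n) ha)) (m : ℕ) :
    ∀ (i : ℤ) {a : RatCircle} (ha : vtx n i = a + pt (m / n)),
      Function.Surjective (M.act (m / n) ha) := by
  induction m with
  | zero =>
    intro i a ha w
    have h0 : ((0 : ℕ) / n : ℚ≥0) = 0 := by simp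
    have h1 : a = vtx n i := by rw [ha, h0, pt_zero, add_zero]
    subst h1
    refine ⟨w, ?_⟩
    simp only [h0]
    exact M.act_zero _ w
  | succ m ih =>
    intro i a ha w
    have h0 : (((m + 1 : ℕ) : ℚ≥0) / n) = m / n + 1 / n := by push_cast; ring
    have h1 : vtx n (i - 1) = a + pt (m / n) := by
      have h2 := vtx_sub_one n i
      rw [ha, h0, pt_add, ← add_assoc] at h2
      exact (add_right_cancel h2).symm
    have h2 : vtx n i = (vtx n (i - 1)) + pt (1 / n) := vtx_sub_one n i
    obtain ⟨v, rfl⟩ := h i h2 w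
    obtain ⟨v, rfl⟩ := ih (i - 1) h1 v
    refine ⟨v, ?_⟩
    rw [M.act_add _ _ h1 h2 (by rw [← h0]; exact ha)]
    simp only [h0]

/-- By nilpotency, a nonzero sheaf needs a generator at some vertex. -/
theorem exists_not_mem_range {M : TorSheaf k} {n : ℕ} (hn : 0 < n) (hM : M.IsLevel n)
    (h0 : M.cls ≠ (zero k).cls) :
    ∃ (i : ℤ) (m : M.V (vtx n i)), ∀ {a : RatCircle} (ha : vtx n i = a + pt (1 / n)),
      m ∉ LinearMap.range (M.act (1 / n) ha) := by
  by_contra hcon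
  push Not at hcon
  have hsurj : ∀ (i : ℤ) {a : RatCircle} (ha : vtx n i = a + pt (1 / n)),
      Function.Surjective (M.act (1 / n) ha) := by
    intro i a ha w
    obtain ⟨a', ha', v, hv⟩ := hcon i w
    have : a' = a := add_right_cancel (ha'.symm.trans ha)
    subst this
    exact ⟨v, hv⟩
  obtain ⟨N, hN⟩ := M.nilpotent
  have hzero : ∀ (i : ℤ) (w : M.V (vtx n i)), w = 0 := by
    intro i w
    have hle : (N : ℚ≥0) ≤ (N * n : ℕ) / n := by
      have hn' : (n : ℚ≥0) ≠ 0 := by exact_mod_cast hn.ne'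
      push_cast
      rw [mul_div_cancel_right₀ _ hn']
    obtain ⟨v, rfl⟩ := surjective_act_vtx hsurj (N * n) i
      (a := vtx n i - pt ((N * n : ℕ) / n)) (sub_add_cancel _ _).symm w
    exact act_eq_zero_of_le hN hle _ v
  refine h0 (Sub.cls_eq_zero.2 fun a => ?_)
  obtain ⟨i, s, hs, ha⟩ := exists_vtx n hn a
  refine ⟨fun v w => ?_⟩
  obtain ⟨v, rfl⟩ := (hM i s hs ha).2 v
  obtain ⟨w, rfl⟩ := (hM i s hs ha).2 w
  rw [hzero i v, hzero i w]

theorem exists_common_level (S : Finset (Cls k)) :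
    ∃ n : ℕ, 0 < n ∧ ∀ M : TorSheaf k, M.cls ∈ S → M.IsLevel n := by
  classical
  induction S using Finset.induction_on with
  | empty => exact ⟨1, one_pos, fun M hM => absurd hM (Finset.notMem_empty _)⟩
  | insert c S _ ih =>
    obtain ⟨n, hn, h⟩ := ih
    obtain ⟨P, rfl⟩ := Quotient.exists_rep c
    obtain ⟨m, hm, hP⟩ := P.exists_level
    refine ⟨n * m, Nat.mul_pos hn hm, fun M hM => ?_⟩
    rcases Finset.mem_insert.1 hM with h1 | h1
    · obtain ⟨e⟩ := cls_eq.1 h1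
      exact (hP.iso e.symm).mul' hn hm
    · exact (h M h1).mul hn hm

/-! ### The subsheaves of an extension by a simple sheaf of a finer level -/

theorem gap_vtx_half {n : ℕ} (hn : 0 < n) {i j : ℤ} :
    1 / ((n * 2 : ℕ) : ℚ≥0) < gap (vtx n j) (vtx n i) := by
  obtain ⟨r, hr0, hr⟩ := exists_gap_vtx hn i j
  have hn' : (0 : ℚ≥0) < n := by exact_mod_cast hn
  rw [hr, lt_div_iff₀ hn']
  have h1 : (1 : ℚ≥0) ≤ r := by exact_mod_cast hr0
  refine lt_of_lt_of_le ?_ h1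
  push_cast
  field_simp
  norm_num

section

variable {M : TorSheaf k} {n : ℕ} (hn : 0 < n) (hM : M.IsLevel (n * 2)) (i : ℤ)
  (m : M.V (vtx (n * 2) (i * 2)))

/-- The simple quotient of `simpleExt` at the fine vertex `i / n - 1 / (2 n)` has no fibre at the
coarse vertices. -/
theorem simpleExt_half_dim (j : ℤ) :
    (simpleExtSub M (Nat.mul_pos hn two_pos) hM (i * 2) m).quot.dim.1 (vtx n j) = 0 := by
  rw [simpleExtSub_quot_dim, if_neg]
  rw [vtx_mul_two]
  exact (gap_vtx_half hn).not_ge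

/-- `M` is the only subsheaf of level `n` of `simpleExt` whose quotient is the simple sheaf. -/
theorem eq_simpleExtSub (hMn : M.IsLevel n)
    {L : Sub (simpleExt M (Nat.mul_pos hn two_pos) hM (i * 2) m)}
    (hL : L.quot.cls = (simpleExtSub M (Nat.mul_pos hn two_pos) hM (i * 2) m).quot.cls)
    (hLn : L.obj.IsLevel n) : L = simpleExtSub M (Nat.mul_pos hn two_pos) hM (i * 2) m := by
  -- both subsheaves are everything at the coarse vertices, which determine a subsheaf of level `n`
  have key : ∀ (P : Sub (simpleExt M (Nat.mul_pos hn two_pos) hM (i * 2) m)),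
      P.quot.cls = (simpleExtSub M (Nat.mul_pos hn two_pos) hM (i * 2) m).quot.cls →
      ∀ j, P.carrier (vtx n j) = ⊤ := by
    intro P hP j
    have h1 : P.quot.dim.1 (vtx n j) = 0 := by
      rw [← clsDim_cls, hP, clsDim_cls]
      exact simpleExt_half_dim hn hM i m j
    have h2 : Module.finrank k (P.quot.V (vtx n j)) = 0 := Int.natCast_eq_zero.1 h1
    exact Submodule.Quotient.subsingleton_iff.1
      (Module.finrank_zero_iff (M := P.quot.V (vtx n j)).1 h2)
  refine Sub.eq_of_isLevel hn (Sub.isLevel_obj hLn) (Sub.isLevel_obj ?_) fun j => ?_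
  · obtain ⟨e⟩ := cls_eq.1 (simpleExtSub_obj (Nat.mul_pos hn two_pos) hM (i * 2) m)
    exact hMn.iso e.symm
  · rw [key L hL, key _ rfl]

/-- If `m` is not in the image of `x ^ (1 / n)`, no subsheaf of `simpleExt` with a quotient of level
`n` is isomorphic to the simple sheaf: the extension does not split, and there is no nonzero
morphism from the simple sheaf to a sheaf of level `n`. -/
theorem simpleExt_no_sub (hMn : M.IsLevel n)
    (hm : ∀ {a : RatCircle} (ha : vtx (n * 2) (i * 2) = a + pt (1 / n)),
      m ∉ LinearMap.range (M.act (1 / n) ha))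
    {L : Sub (simpleExt M (Nat.mul_pos hn two_pos) hM (i * 2) m)}
    (hL : L.obj.cls = (simpleExtSub M (Nat.mul_pos hn two_pos) hM (i * 2) m).quot.cls)
    (hLn : L.quot.IsLevel n) : False := by
  set ε : ℚ≥0 := 1 / (n * 2 : ℕ) with hε
  have hn' : (0 : ℚ≥0) < n := by exact_mod_cast hn
  have hε0 : 0 < ε := by rw [hε]; positivity
  have hεε : (1 : ℚ≥0) / n = ε + ε := by rw [hε]; push_cast; field_simp; norm_num
  have hε1 : ε ≤ 1 := by
    rw [hε, div_le_one (by positivity)]; exact_mod_cast Nat.mul_pos hn two_pos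
  have hεn : ε * n < 1 := by
    rw [← lt_div_iff₀ hn', hεε]; exact lt_add_of_pos_left _ hε0
  have hdim : L.obj.dim = (simpleExtSub M (Nat.mul_pos hn two_pos) hM (i * 2) m).quot.dim := by
    rw [← clsDim_cls, hL, clsDim_cls]
  have hL0 : ∀ j, L.carrier (vtx n j) = ⊥ := by
    intro j
    have h1 : L.obj.dim.1 (vtx n j) = 0 := by rw [hdim]; exact simpleExt_half_dim hn hM i m j
    exact Submodule.finrank_eq_zero.1 (Int.natCast_eq_zero.1 h1)
  -- the generator of the simple sheaf lies at `a`, half way from the vertex `d = (i - 1) / n` to the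
  -- vertex `i / n`
  set d := vtx n (i - 1)
  set a := d + pt ε with ha
  have hcn : vtx (n * 2) (i * 2) = vtx n i := vtx_mul_two i
  have hca : vtx (n * 2) (i * 2) = a + pt ε := by
    rw [ha, add_assoc, ← pt_add, ← hεε, hcn]; exact vtx_sub_one n i
  have hcd : vtx (n * 2) (i * 2) = d + pt (ε + ε) := by rw [← hεε, hcn]; exact vtx_sub_one n i
  have hgap : gap (vtx (n * 2) (i * 2)) a = ε := gap_eq hε0 hε1 hca
  have h1 : L.obj.dim.1 a = 1 := by
    rw [hdim, simpleExtSub_quot_dim, if_pos hgap.le]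
  have h2 : L.carrier a ≠ ⊥ := by
    intro h
    have h3 : Module.finrank k (L.carrier a) = 1 := (Nat.cast_eq_one (R := ℤ)).1 h1
    rw [h, finrank_bot] at h3
    exact zero_ne_one h3
  obtain ⟨w, hw, hw0⟩ := Submodule.exists_mem_ne_zero_of_ne_bot h2
  obtain ⟨⟨v, t⟩, rfl⟩ : ∃ u : M.V a × arc k (vtx (n * 2) (i * 2)) ε a, u = w := ⟨w, rfl⟩
  obtain ⟨v, rfl⟩ := (hMn (i - 1) ε hεn ha).2 v
  -- as `L` vanishes at the vertex `i / n`, so does `x ^ ε` of its element `w`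
  have h3 : (simpleExt M (Nat.mul_pos hn two_pos) hM (i * 2) m).act ε hca
      (M.act ε ha v, t) = 0 := by
    have h4 := L.act_mem ε hca _ hw
    have h5 : L.carrier (vtx (n * 2) (i * 2)) = ⊥ := by rw [hcn]; exact hL0 i
    rw [h5] at h4
    exact (Submodule.mem_bot k).1 h4
  have h4 := (extAct_of_le (m := m) hgap.le hca (M.act ε ha v, t)).symm.trans h3
  have h5 : M.act ε hca (M.act ε ha v) + t.1 • M.act (ε - gap (vtx (n * 2) (i * 2)) a)
    (eq_add_pt_sub_gap hgap.le hca) m = 0 := (Prod.mk.inj h4).1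
  have h6 : M.act (ε - gap (vtx (n * 2) (i * 2)) a) (eq_add_pt_sub_gap hgap.le hca) m = m := by
    simp only [hgap, tsub_self]
    exact M.act_zero _ m
  rw [h6, M.act_add _ _ ha hca hcd] at h5
  by_cases ht : t.1 = 0
  -- an element of `M` at `a` comes from `d`, where `L` vanishes, and `R / L` is of level `n`
  · have ht' : t = 0 := Subtype.ext ht
    subst ht'
    refine hw0 ?_
    have h7 : (simpleExt M (Nat.mul_pos hn two_pos) hM (i * 2) m).act ε ha (v, 0) =
        (M.act ε ha v, 0) := simpleExtSub_act _ _ _ _ ha v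
    have h8 : (L.carrier d).mkQ (v, 0) = 0 := by
      refine (hLn (i - 1) ε hεn ha).1 ?_
      refine Eq.trans ?_ (map_zero (L.quot.act ε ha)).symm
      refine (congrArg (L.carrier a).mkQ h7).trans ?_
      exact (Submodule.Quotient.mk_eq_zero _).2 hw
    have h9 : ((v, 0) : M.V d × arc k (vtx (n * 2) (i * 2)) ε d) ∈ L.carrier d :=
      (Submodule.Quotient.mk_eq_zero _).1 h8
    rw [hL0 (i - 1)] at h9
    have h10 : v = 0 := congrArg Prod.fst (show ((v, 0) : M.V d × arc k _ ε d) = 0 from h9)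
    rw [h10, map_zero]; rfl
  -- otherwise `m` is a multiple of an element `x ^ (1 / n) v`
  · have hcd' : vtx (n * 2) (i * 2) = d + pt (1 / n) := by rw [hεε]; exact hcd
    refine hm hcd' ⟨-(t.1)⁻¹ • v, ?_⟩
    have h7 : M.act (1 / n) hcd' v = M.act (ε + ε) hcd v := by simp only [hεε]
    rw [map_smul, h7, eq_neg_of_add_eq_zero_left h5, smul_neg, neg_smul, neg_neg, smul_smul,
      inv_mul_cancel₀ ht, one_smul]

end

end TorSheaf

/-! ### The center of the Hall algebra -/

theorem isUnit_ups (k : Type u) (m : ℤ) : IsUnit (ups k m) :=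
  IsUnit.of_mul_eq_one (ups k (-m)) (by rw [← ups_add, add_neg_cancel, ups_zero])

open TorSheaf

namespace HallTor

variable {k : Type u} [Field k] [Finite k]

/-- An element of the Hall algebra that commutes, up to scalars, with all characteristic functions
is supported on the zero sheaf. -/
theorem val_eq_zero_of_comm_char {f : HallTor k}
    (hf : ∀ N : TorSheaf k, ∃ r : Scalars k, char N * f = r • (f * char N)) {M : TorSheaf k}
    (h0 : M.cls ≠ (zero k).cls) : f.val M.cls = 0 := by
  classical
  by_contra hfM
  obtain ⟨n, hn, hlev⟩ := exists_common_level (Finsupp.support (M := Scalars k) f)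
  have hlev' : ∀ P : TorSheaf k, f.val P.cls ≠ 0 → P.IsLevel n := fun P hP =>
    hlev P (Finsupp.mem_support_iff.2 hP)
  have hMn := hlev' M hfM
  have hM2 : M.IsLevel (n * 2) := hMn.mul hn two_pos
  obtain ⟨i, m, hm⟩ := exists_not_mem_range hn hMn h0
  obtain ⟨m, hm⟩ : ∃ m : M.V (vtx (n * 2) (i * 2)), ∀ {a : RatCircle}
      (ha : vtx (n * 2) (i * 2) = a + pt (1 / n)), m ∉ LinearMap.range (M.act (1 / n) ha) := by
    rw [vtx_mul_two]
    exact ⟨m, hm⟩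
  let R := simpleExt M (Nat.mul_pos hn two_pos) hM2 (i * 2) m
  let L : Sub R := simpleExtSub M (Nat.mul_pos hn two_pos) hM2 (i * 2) m
  have hLM : L.obj.cls = M.cls := simpleExtSub_obj _ _ _ _
  obtain ⟨r, hr⟩ := hf L.quot
  have h1 : (char L.quot * f).val R.cls = ups k (eulerTor L.quot.dim L.obj.dim) * f.val M.cls := by
    rw [val_mul]
    unfold hallFun
    rw [finsum_eq_single _ L]
    · have h2 : (char L.quot).val L.quot.cls = 1 := Finsupp.single_eq_same
      change _ * ((char L.quot).val L.quot.cls * f.val L.obj.cls) = _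
      rw [h2, one_mul, hLM]
    · intro P hP
      change _ * ((char L.quot).val P.quot.cls * f.val P.obj.cls) = 0
      by_cases h3 : P.quot.cls = L.quot.cls
      · by_cases h4 : f.val P.obj.cls = 0
        · rw [h4, mul_zero, mul_zero]
        · exact absurd (eq_simpleExtSub hn hM2 i m hMn h3 (hlev' _ h4)) hP
      · have h4 : (char L.quot).val P.quot.cls = 0 := Finsupp.single_eq_of_ne h3
        rw [h4, zero_mul, mul_zero]
  have h2 : (f * char L.quot).val R.cls = 0 := by
    rw [val_mul]
    unfold hallFun
    refine finsum_eq_zero_of_forall_eq_zero fun P => ?_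
    change _ * (f.val P.quot.cls * (char L.quot).val P.obj.cls) = 0
    by_cases h3 : P.obj.cls = L.quot.cls
    · by_cases h4 : f.val P.quot.cls = 0
      · rw [h4, zero_mul, mul_zero]
      · exact (simpleExt_no_sub hn hM2 i m hMn hm h3 (hlev' _ h4)).elim
    · have h4 : (char L.quot).val P.obj.cls = 0 := Finsupp.single_eq_of_ne h3
      rw [h4, mul_zero, mul_zero]
  rw [hr, val_smul, h2, mul_zero] at h1
  exact hfM ((isUnit_ups k _).mul_right_eq_zero.1 h1.symm)

theorem eq_smul_one_of_comm_char {f : HallTor k}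
    (hf : ∀ N : TorSheaf k, ∃ r : Scalars k, char N * f = r • (f * char N)) :
    f = f.val (zero k).cls • (1 : HallTor k) := by
  refine ext_cls fun M => ?_
  rw [val_smul]
  by_cases h : M.cls = (zero k).cls
  · have h1 : (1 : HallTor k).val (zero k).cls = 1 := Finsupp.single_eq_same
    rw [h, h1, mul_one]
  · rw [val_eq_zero_of_comm_char hf h, val_one_of_ne h, mul_zero]

theorem center_eq_bot : Subalgebra.center (Scalars k) (HallTor k) = ⊥ := by
  refine le_antisymm (fun f hf => ?_) bot_le
  rw [Subalgebra.mem_center_iff] at hf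
  rw [Algebra.mem_bot]
  refine ⟨f.val (zero k).cls, ?_⟩
  rw [Algebra.algebraMap_eq_smul_one]
  exact (eq_smul_one_of_comm_char fun N => ⟨1, by rw [one_smul, hf]⟩).symm

end HallTor

/-! ### The symmetrised Euler form -/

/-- The jump `f₋(x) - f₊(x)`. -/
def jump (f : RatCircle → ℤ) (x : RatCircle) : ℤ := leftLimit f x - rightLimit f x

theorem leftLimit_vtx {n : ℕ} (hn : 0 < n) {f : RatCircle → ℤ} (hf : IsStep n f) (i : ℤ) :
    leftLimit f (vtx n i) = f (vtx n (i - 1)) := by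
  have hn' : (0 : ℚ) < n := by exact_mod_cast hn
  have h := leftLimit_eq hn hf (i - 1) (1 / n) (by positivity) (by field_simp; rfl)
  rw [← vtx] at h
  rw [← h, vtx]
  congr 2
  push_cast
  ring

theorem jump_vtx {n : ℕ} (hn : 0 < n) {f : RatCircle → ℤ} (hf : IsStep n f) (i : ℤ) :
    jump f (vtx n i) = f (vtx n (i - 1)) - f (vtx n i) := by
  rw [jump, leftLimit_vtx hn hf, rightLimit_eq hn hf]

theorem jump_eq_zero {n : ℕ} (hn : 0 < n) {f : RatCircle → ℤ} (hf : IsStep n f) {x : RatCircle}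
    (hx : ∀ i, x ≠ vtx n i) : jump f x = 0 := by
  obtain ⟨i, s, hs, hs', rfl⟩ := exists_cell n hn x
  rcases hs.eq_or_lt with rfl | h
  · exact (hx i (by rw [add_zero, vtx])).elim
  · rw [jump, rightLimit_eq hn hf, leftLimit_eq hn hf i s h hs'.le, hf i s hs hs', sub_self]

theorem jump_finite (f : StepFun) : (Function.support (jump f)).Finite := by
  obtain ⟨n, hn, hf⟩ := f.2
  refine (finite_vertices n hn).subset fun x hx => ?_
  by_contra hcon
  exact hx (jump_eq_zero hn hf fun i hi => hcon ⟨i, hi⟩)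

/-- The jumps of a function on the circle cancel. -/
theorem finsum_jump (f : StepFun) : ∑ᶠ x, jump f x = 0 := by
  obtain ⟨n, hn, hf⟩ := f.2
  have hfin := finite_vertices n hn
  have hmem : ∀ x, x ∈ hfin.toFinset ↔ ∃ i : ℤ, x = vtx n i := fun x => by
    rw [Set.Finite.mem_toFinset]; rfl
  rw [finsum_eq_sum_of_support_subset (s := hfin.toFinset)]
  · have h1 : ∀ x ∈ hfin.toFinset, jump f x = f.1 (x - pt (1 / n)) - f.1 x := by
      intro x hx
      obtain ⟨i, rfl⟩ := (hmem x).1 hx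
      rw [jump_vtx hn hf, sub_eq_of_eq_add (vtx_sub_one n i)]
    rw [Finset.sum_congr rfl h1, Finset.sum_sub_distrib, sub_eq_zero]
    refine Finset.sum_equiv (Equiv.subRight (pt (1 / n))) (fun x => ?_) fun x _ => rfl
    rw [hmem, hmem]
    constructor
    · rintro ⟨i, rfl⟩
      exact ⟨i - 1, sub_eq_of_eq_add (vtx_sub_one n i)⟩
    · rintro ⟨i, hi⟩
      exact ⟨i + 1, by rw [vtx_add_one, ← hi]; exact (sub_add_cancel _ _).symm⟩
  · intro x hx
    rw [Finset.mem_coe, hmem]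
    by_contra hcon
    exact hx (jump_eq_zero hn hf fun i hi => hcon ⟨i, hi⟩)

theorem IsStep.mul_fun {n : ℕ} {f g : RatCircle → ℤ} (hf : IsStep n f) (hg : IsStep n g) :
    IsStep n (f * g) := fun i s hs hs' => by
  simp only [Pi.mul_apply]; rw [hf i s hs hs', hg i s hs hs']

/-- The symmetrised Euler form of torsion classes is `∑_x Df(x) Dg(x)`, where `D` is the jump: the
difference of the two sides is the sum of the jumps of `f g`. -/
theorem eulerTor_add_eulerTor (f g : StepFun) :
    eulerTor f g + eulerTor g f = ∑ᶠ x, jump f x * jump g x := by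
  obtain ⟨n, hn, hf, hg⟩ := exists_common f g
  let fg : StepFun := ⟨f.1 * g.1, n, hn, hf.mul_fun hg⟩
  have hfg : IsStep n (fg : RatCircle → ℤ) := hf.mul_fun hg
  have hfin : (Function.support fun x => jump f x * jump g x).Finite :=
    (jump_finite f).subset fun x hx h => hx (by simp only [h, zero_mul])
  rw [← add_zero (∑ᶠ x, _), ← finsum_jump fg, ← finsum_add_distrib hfin (jump_finite fg)]
  unfold eulerTor
  rw [← finsum_add_distrib (finite_jumps f g) (finite_jumps g f)]
  refine finsum_congr fun x => ?_
  have h1 : rightLimit fg x = rightLimit f x * rightLimit g x := by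
    rw [rightLimit_eq hn hf, rightLimit_eq hn hg, rightLimit_eq hn hfg]; rfl
  have h2 : leftLimit fg x = leftLimit f x * leftLimit g x := by
    obtain ⟨i, s, hs, hs', rfl⟩ := exists_cell_left n hn x
    rw [leftLimit_eq hn hf i s hs hs', leftLimit_eq hn hg i s hs hs',
      leftLimit_eq hn hfg i s hs hs']
    rfl
  rw [jump, jump, jump, h1, h2]
  ring

theorem symEuler_torsion {genus : ℕ} (α : KNum genus) (g : StepFun) :
    symEuler α (KNum.mk 0 g) = ∑ᶠ x, jump α.2 x * jump g x - α.1 * jump g 0 := by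
  rw [← eulerTor_add_eulerTor, jump]
  change (α.1 * 0 * (1 - (genus : ℤ)) + α.1 * rightLimit g 0 - 0 * leftLimit α.2 0 +
    eulerTor α.2 g) + (0 * α.1 * (1 - (genus : ℤ)) + 0 * rightLimit α.2 0 - α.1 * leftLimit g 0 +
    eulerTor g α.2) = _
  ring

theorem jump_constOne (x : RatCircle) : jump constOne x = 0 := by
  have h : IsStep 1 (constOne : RatCircle → ℤ) := fun _ _ _ _ => rfl
  obtain ⟨i, s, hs, hs', rfl⟩ := exists_cell_left 1 one_pos x
  rw [jump, rightLimit_eq one_pos h, leftLimit_eq one_pos h i s hs hs']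
  exact sub_self 1

theorem symEuler_deltaClass {genus : ℕ} (g : StepFun) :
    symEuler (deltaClass genus) (KNum.mk 0 g) = 0 := by
  rw [symEuler_torsion]
  have h1 : ∀ x, jump (deltaClass genus).2 x = 0 := jump_constOne
  have h2 : (deltaClass genus).1 = 0 := rfl
  simp [h1, h2]

/-! ### Classes orthogonal to all torsion sheaves -/

theorem zsmul_mk {genus : ℕ} (z r : ℤ) (f : StepFun) :
    z • (KNum.mk r f : KNum genus) = KNum.mk (z * r) (z • f) := rfl

theorem step_ext {n : ℕ} (hn : 0 < n) {f g : RatCircle → ℤ} (hf : IsStep n f) (hg : IsStep n g)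
    (h : ∀ i, f (vtx n i) = g (vtx n i)) : f = g := by
  funext x
  obtain ⟨i, s, hs, hs', rfl⟩ := exists_cell n hn x
  rw [hf i s hs hs', hg i s hs hs']
  exact h i

section

open TorSheaf

variable (k : Type u) [Field k]

theorem isStep_dim {k : Type u} [Field k] {M : TorSheaf k} {n : ℕ} (h : M.IsLevel n) :
    IsStep n M.dim := by
  intro i s hs hs'
  have h1 : ((i / n + s : ℚ) : RatCircle) = vtx n i + pt ⟨s, hs⟩ := by simp [vtx, pt]
  have h2 := h i ⟨s, hs⟩
    (by exact_mod_cast (show ((⟨s, hs⟩ : ℚ≥0) : ℚ) * n < 1 from hs')) h1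
  exact congrArg Nat.cast (LinearEquiv.ofBijective _ h2).finrank_eq.symm

theorem zero_isLevel (n : ℕ) : (zero k).IsLevel n := fun _ _ _ _ _ =>
  ⟨fun _ _ _ => Subsingleton.elim (α := PUnit) _ _, fun _ => ⟨PUnit.unit, rfl⟩⟩

/-- The simple sheaf on the arc of length `1 / n` that ends at `j / n`. -/
def simpleSheaf {n : ℕ} (hn : 0 < n) (j : ℤ) : TorSheaf k :=
  (simpleExtSub (zero k) hn (zero_isLevel k n) j 0).quot

theorem simpleSheaf_dim {n : ℕ} (hn : 0 < n) (j : ℤ) (a : RatCircle) :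
    (simpleSheaf k hn j).dim.1 a = if gap (vtx n j) a ≤ 1 / n then 1 else 0 :=
  simpleExtSub_quot_dim _ _ _ _ a

theorem simpleSheaf_isStep {n : ℕ} (hn : 0 < n) (j : ℤ) : IsStep n (simpleSheaf k hn j).dim := by
  have h1 := (simpleExtSub (zero k) hn (zero_isLevel k n) j 0).dim_add
  rw [← clsDim_cls (Sub.obj _), simpleExtSub_obj, clsDim_cls, dim_zero, add_zero] at h1
  rw [simpleSheaf, h1]
  exact isStep_dim (simpleExt_isLevel _ _ _ _)

/-- Among the vertices of the coarse subdivision, the class of a simple sheaf of the fine one jumps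
only at the end point of its arc. -/
theorem jump_simpleSheaf {n : ℕ} (hn : 0 < n) (i j : ℤ) :
    jump (simpleSheaf k (Nat.mul_pos hn two_pos) (j * 2)).dim (vtx n i) =
      if vtx n i = vtx n j then 1 else 0 := by
  have h0 : ∀ i : ℤ, (simpleSheaf k (Nat.mul_pos hn two_pos) (j * 2)).dim.1 (vtx n i) = 0 :=
    fun i => simpleExt_half_dim hn _ j _ i
  have h1 : vtx n i = vtx (n * 2) (i * 2 - 1) + pt (1 / (n * 2 : ℕ)) := by
    rw [← vtx_sub_one, vtx_mul_two]
  have hn2 : (0 : ℚ≥0) < (n * 2 : ℕ) := by exact_mod_cast Nat.mul_pos hn two_pos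
  rw [← vtx_mul_two i, jump_vtx (Nat.mul_pos hn two_pos) (simpleSheaf_isStep k _ _), vtx_mul_two i,
    h0, sub_zero, simpleSheaf_dim]
  congr 1
  rw [eq_iff_iff]
  constructor
  · intro h
    obtain ⟨r, hr0, hr⟩ := exists_gap_vtx (Nat.mul_pos hn two_pos) (i * 2 - 1) (j * 2)
    have h2 : gap (vtx (n * 2) (j * 2)) (vtx (n * 2) (i * 2 - 1)) = 1 / (n * 2 : ℕ) := by
      refine le_antisymm h ?_
      rw [hr]
      gcongr
      exact_mod_cast hr0
    rw [h1, ← h2, ← eq_add_pt_gap, vtx_mul_two]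
  · intro h
    refine (gap_eq (by positivity) ?_ ?_).le
    · rw [div_le_one hn2]
      exact_mod_cast Nat.mul_pos hn two_pos
    · rw [vtx_mul_two, ← h, h1]

/-- A class orthogonal to all torsion sheaves is a multiple of `δ`. A jump of `f` at a point
different from `0` is seen by a small simple sheaf that ends there. Hence, going around the circle,
`f` has no jump, and the rank, which is the jump of `f` at `0`, is zero. -/
theorem eq_zsmul_deltaClass {genus : ℕ} {α : KNum genus}
    (h : ∀ N : TorSheaf k, symEuler α (clsNum genus N.cls) = 0) :
    ∃ z : ℤ, α = z • deltaClass genus := by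
  set r := α.1
  set f := α.2
  obtain ⟨n, hn, hf⟩ := f.2
  have hn' : (n : ℚ) ≠ 0 := by exact_mod_cast hn.ne'
  have v0 : vtx n 0 = 0 := by simp [vtx]
  have key : ∀ j : ℤ, f.1 (vtx n (j - 1)) - f.1 (vtx n j) = if vtx n j = 0 then r else 0 := by
    intro j
    have h1 := h (simpleSheaf k (Nat.mul_pos hn two_pos) (j * 2))
    rw [clsNum, clsDim_cls, symEuler_torsion, finsum_eq_single _ (vtx n j), ← v0,
      jump_simpleSheaf k hn, jump_simpleSheaf k hn, if_pos rfl, mul_one, sub_eq_zero] at h1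
    · rw [← jump_vtx hn hf]
      refine h1.trans ?_
      rw [v0]
      by_cases h0 : vtx n j = 0
      · rw [if_pos h0, if_pos h0.symm]; exact mul_one r
      · rw [if_neg h0, if_neg (Ne.symm h0)]; exact mul_zero r
    · intro x hx
      by_cases hv : ∃ i, x = vtx n i
      · obtain ⟨i, rfl⟩ := hv
        rw [jump_simpleSheaf k hn, if_neg hx, mul_zero]
      · push Not at hv
        have h2 : jump f x = 0 := jump_eq_zero hn hf hv
        exact mul_eq_zero_of_left h2 _
  have hconst : ∀ m : ℕ, m < n → f.1 (vtx n m) = f.1 0 := by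
    intro m
    induction m with
    | zero => intro _; rw [Nat.cast_zero, v0]
    | succ m ih =>
      intro hm
      have h1 := key ((m + 1 : ℕ) : ℤ)
      rw [if_neg] at h1
      · rw [← ih (by omega), ← sub_eq_zero.1 h1]
        rw [Nat.cast_succ, add_sub_cancel_right]
      · intro h0
        obtain ⟨z, hz⟩ := (AddCircle.coe_eq_zero_iff (1 : ℚ)).1 h0
        have h3 : ((z * n : ℤ) : ℚ) = ((m + 1 : ℕ) : ℤ) := by
          rw [Int.cast_mul, Int.cast_natCast, ← eq_div_iff hn', ← hz]; simp
        have h4 : z * n = ((m + 1 : ℕ) : ℤ) := by exact_mod_cast h3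
        have h5 : (n : ℤ) ∣ ((m + 1 : ℕ) : ℤ) := ⟨z, by rw [← h4, mul_comm]⟩
        exact absurd (Nat.le_of_dvd (Nat.succ_pos m) (Int.natCast_dvd_natCast.1 h5)) (by omega)
  have hall : ∀ i : ℤ, f.1 (vtx n i) = f.1 0 := fun i => by
    obtain ⟨j, hj⟩ := vtx_fin n hn i
    rw [hj]
    exact hconst j j.2
  have hr0 : r = 0 := by
    have h1 := key 0
    rw [hall, hall, sub_self, if_pos v0] at h1
    exact h1.symm
  refine ⟨f.1 0, ?_⟩
  rw [deltaClass, zsmul_mk, mul_zero]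
  refine Prod.ext hr0 (Subtype.ext ?_)
  refine step_ext hn hf (fun _ _ _ _ => rfl) fun i => ?_
  rw [hall]
  exact (mul_one _).symm

end

section

variable {k : Type u} [Field k] [Finite k]

/-- As `υ ^ (2 m) = q ^ m` is a rational number different from `1`, the element `υ ^ m - 1` is
invertible for `m ≠ 0`, although the ring of scalars is no domain if `q` is a square. -/
theorem isUnit_ups_sub_one {m : ℤ} (hm : m ≠ 0) : IsUnit (ups k m - 1) := by
  have key : ∀ n : ℕ, n ≠ 0 → IsUnit (ups k n - 1) := by
    intro n hn
    let φ : ℚ →+* Scalars k := (Ideal.Quotient.mk _).comp LaurentPolynomial.C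
    have h1 : ups k 2 = φ (Nat.card k) := by
      refine Ideal.Quotient.eq.2 (Ideal.subset_span rfl)
    have h2 : ups k (n + n) = φ ((Nat.card k : ℚ) ^ n) := by
      rw [map_pow, ← h1, ups, ups, ← map_pow, LaurentPolynomial.T_pow]
      congr 2
      ring
    have h3 : (ups k n - 1) * (ups k n + 1) = φ ((Nat.card k : ℚ) ^ n - 1) := by
      rw [map_sub, map_one, ← h2, ups_add]
      ring
    have h4 : (Nat.card k : ℚ) ^ n - 1 ≠ 0 := by
      have h5 : 1 < Nat.card k := Finite.one_lt_card
      have h6 : (1 : ℚ) < (Nat.card k : ℚ) ^ n := one_lt_pow₀ (by exact_mod_cast h5) hn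
      exact (sub_pos.2 h6).ne'
    refine isUnit_of_mul_isUnit_left (y := ups k n + 1) ?_
    rw [h3]
    exact h4.isUnit.map φ
  rcases m.eq_nat_or_neg with ⟨n, rfl | rfl⟩
  · exact key n (by simpa using hm)
  · have h1 : ups k (-n) - 1 = -(ups k (-n) * (ups k n - 1)) := by
      rw [mul_sub, ← ups_add, neg_add_cancel, ups_zero]
      ring
    rw [h1]
    exact ((isUnit_ups k _).mul (key n (by simpa using hm))).neg

end

open TorSheaf

/-! ### The center of the extended Hall algebra -/

namespace HallTw

variable {k : Type u} [Field k] [Finite k] {genus : ℕ}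

/-- The coefficient of `k_α`. -/
def coeff (x : HallTw k genus) (α : KNum genus) : HallTor k :=
  SkewMonoidAlgebra.coeff x (Multiplicative.ofAdd α)

theorem twist_one (α : KNum genus) : twist α (1 : HallTor k) = 1 :=
  smul_one (Multiplicative.ofAdd α)

theorem coeff_mul_mk (x : HallTw k genus) (g : HallTor k) (α : KNum genus) :
    (x * mk g 0).coeff α = x.coeff α * twist α g :=
  SkewMonoidAlgebra.coeff_mul_single_one x g (Multiplicative.ofAdd α)

theorem coeff_mk_mul (x : HallTw k genus) (g : HallTor k) (α : KNum genus) :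
    (mk g 0 * x).coeff α = g * x.coeff α :=
  (SkewMonoidAlgebra.coeff_single_one_mul x g (Multiplicative.ofAdd α))

theorem twist_char (α : KNum genus) (N : TorSheaf k) :
    twist α (HallTor.char N) = weight α N.cls • HallTor.char N :=
  HallTor.ext_cls fun M => by
    rw [val_twist, HallTor.val_smul]
    by_cases h : M.cls = N.cls
    · rw [h]
    · have h2 : (HallTor.char N).val M.cls = 0 := Finsupp.single_eq_of_ne h
      rw [h2, mul_zero, mul_zero]

/-- The coefficients of a central element are scalars, and only the `k_{m δ}` occur. -/
theorem coeff_of_mem_center {x : HallTw k genus} (hx : x ∈ Subalgebra.center (Scalars k) _)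
    (α : KNum genus) (h0 : x.coeff α ≠ 0) :
    (∃ c : Scalars k, x.coeff α = c • (1 : HallTor k)) ∧ ∃ z : ℤ, α = z • deltaClass genus := by
  rw [Subalgebra.mem_center_iff] at hx
  have hcomm : ∀ N : TorSheaf k, HallTor.char N * x.coeff α =
      weight α N.cls • (x.coeff α * HallTor.char N) := by
    intro N
    have h1 := congrArg (fun y => coeff y α) (hx (mk (HallTor.char N) 0))
    simp only [coeff_mul_mk, coeff_mk_mul] at h1
    rw [h1, twist_char, mul_smul_comm]
  obtain ⟨c, hc⟩ : ∃ c : Scalars k, x.coeff α = c • (1 : HallTor k) :=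
    ⟨_, HallTor.eq_smul_one_of_comm_char fun N => ⟨_, hcomm N⟩⟩
  refine ⟨⟨c, hc⟩, eq_zsmul_deltaClass k fun N => ?_⟩
  by_contra hN
  have h1 := congrArg (fun f => HallTor.val f N.cls) (hcomm N)
  have h2 : (HallTor.char N).val N.cls = 1 := Finsupp.single_eq_same
  simp only [hc, smul_one_mul, mul_smul_one, HallTor.val_smul, h2, mul_one] at h1
  have h3 : c * (weight α N.cls - 1) = 0 := by
    rw [mul_sub, mul_one, sub_eq_zero, mul_comm, ← h1]
  have h4 : c = 0 := (isUnit_ups_sub_one hN).mul_left_eq_zero.1 h3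
  exact h0 (by rw [hc, h4]; exact zero_smul (Scalars k) (1 : HallTor k))

theorem kk_mem_center {δ : KNum genus}
    (h : ∀ g : StepFun, symEuler δ (KNum.mk 0 g) = 0) :
    kk δ ∈ Subalgebra.center (Scalars k) (HallTw k genus) := by
  rw [Subalgebra.mem_center_iff]
  intro x
  have ht : ∀ f : HallTor k, twist δ f = f := fun f => HallTor.ext_cls fun M => by
    rw [val_twist, weight, clsNum, h, ups_zero, one_mul]
  induction x using induction with
  | h0 => rw [zero_mul, mul_zero]
  | hadd x y hx hy => rw [add_mul, mul_add, hx, hy]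
  | hmk f α => rw [kk, mk_mul_mk, mk_mul_mk, ht, twist_one, one_mul, mul_one, add_comm]

theorem kk_add (α β : KNum genus) : (kk (α + β) : HallTw k genus) = kk α * kk β := by
  rw [kk, kk, kk, mk_mul_mk, twist_one, one_mul]

theorem kk_zero : (kk 0 : HallTw k genus) = 1 := rfl

theorem kk_nsmul (n : ℕ) (α : KNum genus) : (kk (n • α) : HallTw k genus) = kk α ^ n := by
  induction n with
  | zero => rw [zero_nsmul, kk_zero, pow_zero]
  | succ n ih => rw [succ_nsmul, kk_add, ih, pow_succ]

theorem kk_zsmul_mem_adjoin (z : ℤ) (α : KNum genus) :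
    (kk (z • α) : HallTw k genus) ∈ Algebra.adjoin (Scalars k) {kk α, kk (-α)} := by
  rcases z.eq_nat_or_neg with ⟨n, rfl | rfl⟩
  · rw [natCast_zsmul, kk_nsmul]
    exact pow_mem (Algebra.subset_adjoin (Set.mem_insert _ _)) n
  · rw [neg_zsmul, natCast_zsmul, ← neg_nsmul, kk_nsmul]
    exact pow_mem (Algebra.subset_adjoin (Set.mem_insert_of_mem _ (Set.mem_singleton _))) n

theorem center_eq_adjoin :
    Subalgebra.center (Scalars k) (HallTw k genus) =
      Algebra.adjoin (Scalars k) {kk (deltaClass genus), kk (-deltaClass genus)} := by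
  refine le_antisymm (fun x hx => ?_) (Algebra.adjoin_le ?_)
  · have h1 : x = ∑ a ∈ SkewMonoidAlgebra.support x, mk (x.coeff a.toAdd) a.toAdd :=
      (SkewMonoidAlgebra.sum_single x).symm
    rw [h1]
    refine Subalgebra.sum_mem _ fun a ha => ?_
    obtain ⟨⟨c, hc⟩, z, hz⟩ := coeff_of_mem_center hx a.toAdd
      (SkewMonoidAlgebra.mem_support_iff.1 ha)
    rw [hc, ← smul_mk, hz]
    exact Subalgebra.smul_mem _ (kk_zsmul_mem_adjoin z _) c
  · rintro x (hx | hx)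
    · rw [hx]
      exact kk_mem_center symEuler_deltaClass
    · rw [Set.mem_singleton_iff.1 hx]
      refine kk_mem_center fun g => ?_
      have h1 := symEuler_add_left (deltaClass genus) (-deltaClass genus) (KNum.mk 0 g)
      rw [add_neg_cancel, symEuler_zero_left, symEuler_deltaClass, zero_add] at h1
      exact h1.symm

end HallTw

end InfiniteRootHall

end

theorem mainTheorem5 {k : Type*} [Field k] [Finite k] (genus : ℕ) :
    Subalgebra.center (InfiniteRootHall.Scalars k) (InfiniteRootHall.HallTw k genus) =
      Algebra.adjoin (InfiniteRootHall.Scalars k)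
        {InfiniteRootHall.HallTw.kk (InfiniteRootHall.deltaClass genus),
          InfiniteRootHall.HallTw.kk (-InfiniteRootHall.deltaClass genus)} ∧
    Subalgebra.center (InfiniteRootHall.Scalars k) (InfiniteRootHall.HallTor k) = ⊥ :=
  ⟨InfiniteRootHall.HallTw.center_eq_adjoin, InfiniteRootHall.HallTor.center_eq_bot⟩
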